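/- Let $(A,\Delta)$ be a regular multiplier Hopf algebra over $\mathbb C$ with a fixed non-zero left integral $\varphi$, that is, $(\iota\otimes\varphi)\Delta(a)=\varphi(a)1$ in the multiplier algebra $M(A)$ for all $a\in A$. Here $A$ is a (possibly non-unital) algebra with non-degenerate product, $\Delta:A\to M(A\otimes A)$ is a coassociative homomorphism, and the maps $a\otimes b\mapsto \Delta(a)(1\otimes b),\ (a\otimes 1)\Delta(b),\ \Delta(a)(b\otimes 1),\ (1\otimes a)\Delta(b)$ are bijections of $A\otimes A$. Let $\varepsilon$ be the counit, $S$ the antipode and $\psi=\varphi\circ S$. Let $\sigma,\sigma'$ be the modular automorphisms, characterized by $\varphi(ab)=\varphi(b\sigma(a))$ and $\psi(ab)=\psi(b\sigma'(a))$, and let $\delta\in M(A)$ be the modular element, the invertible multiplier characterized by $\varphi(S(a))=\varphi(a\delta)$ and $\varphi(S^{-1}(a))=\varphi(\delta a)$. Let $B=\widehat A=\{\varphi(\,\cdot\,c): c\in A\}$, with the evaluation pairing $\langle a,b\rangle=b(a)$. For $a\in A$, $b\in B$ put $a\triangleleft b=(b\otimes\iota)\Delta(a)\in A$ and $b\triangleright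 a=(\iota\otimes b)\Delta(a)\in A$. The product of $B$ is given by $\langle a,bb'\rangle=\langle a\triangleleft b,b'\rangle$ and the antipode of $B$ by $\langle a,S(b)\rangle=\langle S(a),b\rangle$. For $m\in M(B)$, the extended pairing $\langle\,\cdot\,,m\rangle$ is the linear functional on $A$ determined by $\langle a\triangleleft b,m\rangle=\langle a,bm\rangle$ and $\langle b\triangleright a,m\rangle=\langle a,mb\rangle$. Let $\widehat\psi,\widehat\varphi$ be the right and left integrals on $B$ given by $\widehat\psi(b)=\varepsilon(c)$ if $b=\varphi(\,\cdot\,c)$, and $\widehat\varphi(b)=\varepsilon(c)$ if $b=\psi(S(\,\cdot\,)c)$. Let $\widehat\sigma,\widehat\sigma'$ be the modular automorphisms of $\widehat\varphi,\widehat\psi$ on $B$, and let $\widehat\delta\in M(B)$ be the modular element of $B$, the invertible multiplier characterized by $\widehat\varphi(S(b))=\widehat\varphi(b\widehat\delta)$ and $\widehat\varphi(S^{-1}(b))=\widehat\varphi(\widehat\delta b)$. Then all these objects exist (including the extended pairings with $\widehat\delta$ and $\widehat\delta^{-1}$), and the following hold. 1. For all $a\in A$, $$\langle a,\widehat\delta\rangle=\varepsilon(\sigma^{-1}(a))=\varepsilon({\sigma'}^{-1}(a)),\qquad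 \langle a,\widehat\delta^{-1}\rangle=\varepsilon(\sigma(a))=\varepsilon(\sigma'(a)).$$ 2. For all $a\in A$ and $b\in B$, $$\langle a,\widehat\sigma(b)\rangle=\langle S^2(a)\delta^{-1},b\rangle,\qquad \langle a,\widehat\sigma'(b)\rangle=\langle\delta^{-1}S^{-2}(a),b\rangle.$$ 3. If $b=\varphi(\,\cdot\,c)$ and $b'=\varphi(\,\cdot\,c')$ with $c,c'\in A$, then $\widehat\psi(bb')=\varphi(S^{-1}(c')c)$. -/

import Mathlib

open scoped TensorProduct

/-! ### Multiplier algebras -/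

section MultiplierAlgebra

variable (A : Type*) [NonUnitalRing A] [Module ℂ A] [SMulCommClass ℂ A A] [IsScalarTower ℂ A A]

/-- The multiplier algebra `M(A)`: pairs `(L, R)` of linear maps with `a (L b) = (R a) b`, where
`L b` is thought of as `m b` and `R a` as `a m`. The second component carries the opposite
product, so that `(m n) b = m (n b)` and `a (m n) = (a m) n`. -/
def multiplierAlgebra : Subalgebra ℂ (Module.End ℂ A × (Module.End ℂ A)ᵐᵒᵖ) where
  carrier := {m | ∀ a b : A, a * m.1 b = m.2.unop a * b}
  mul_mem' := by
    intro m n hm hn a b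
    have h1 := hm a (n.1 b)
    have h2 := hn (m.2.unop a) b
    simpa [Module.End.mul_apply] using h1.trans h2
  add_mem' := by
    intro m n hm hn a b
    have h1 := hm a b
    have h2 := hn a b
    simp [mul_add, add_mul, h1, h2]
  algebraMap_mem' := by
    intro r a b
    simp [Prod.algebraMap_apply, Module.algebraMap_end_apply, MulOpposite.algebraMap_apply,
      mul_smul_comm, smul_mul_assoc]

/-- `M(A)` as a unital algebra. -/
abbrev Multiplier : Type _ := multiplierAlgebra A

end MultiplierAlgebra

namespace Multiplier

variable {A : Type*} [NonUnitalRing A] [Module ℂ A] [SMulCommClass ℂ A A] [IsScalarTower ℂ A A]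

/-- `m.lmul a` is the element `m a` of `A`. -/
def lmul (m : Multiplier A) : A →ₗ[ℂ] A := m.1.1

/-- `m.rmul a` is the element `a m` of `A`. -/
def rmul (m : Multiplier A) : A →ₗ[ℂ] A := m.1.2.unop

lemma compat (m : Multiplier A) (a b : A) : a * m.lmul b = m.rmul a * b := m.2 a b

/-- The canonical map `A → M(A)`. -/
def of (a : A) : Multiplier A :=
  ⟨(LinearMap.mul ℂ A a, MulOpposite.op ((LinearMap.mul ℂ A).flip a)),
    fun x y => (mul_assoc x a y).symm⟩

/-- The multiplier `m ⊗ n` of `A ⊗ A`. -/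
def tmul (m n : Multiplier A) : Multiplier (A ⊗[ℂ] A) :=
  ⟨(TensorProduct.map m.lmul n.lmul, MulOpposite.op (TensorProduct.map m.rmul n.rmul)), by
    intro x y
    induction x with
    | zero => simp
    | add x x' hx hx' =>
      simp only [add_mul, map_add] at hx hx' ⊢
      rw [hx, hx']
    | tmul a a' =>
      induction y with
      | zero => simp
      | add y y' hy hy' =>
        simp only [mul_add, map_add] at hy hy' ⊢
        rw [hy, hy']
      | tmul b b' => simp [compat]⟩

@[simp] lemma lmul_of (a b : A) : (of a).lmul b = a * b := rfl
@[simp] lemma rmul_of (a b : A) : (of a).rmul b = b * a := rfl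
@[simp] lemma lmul_one (b : A) : (1 : Multiplier A).lmul b = b := rfl
@[simp] lemma lmul_mul (m n : Multiplier A) (b : A) : (m * n).lmul b = m.lmul (n.lmul b) := rfl
@[simp] lemma lmul_tmul (m n : Multiplier A) (b c : A) :
    (tmul m n).lmul (b ⊗ₜ c) = m.lmul b ⊗ₜ n.lmul c := rfl

end Multiplier

/-! ### Regular multiplier Hopf algebras and integrals -/

/-- A regular multiplier Hopf algebra: a non-degenerate algebra `A` over `ℂ` with a homomorphism
`Δ : A → M(A ⊗ A)` such that the four canonical maps
`a ⊗ b ↦ Δ(a)(1 ⊗ b)`, `(a ⊗ 1)Δ(b)`, `Δ(a)(b ⊗ 1)`, `(1 ⊗ a)Δ(b)`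
take values in `A ⊗ A` and are bijections of `A ⊗ A` (`T₁`, `T₂`, `T₃`, `T₄`; they are determined
by `Δ`), and `Δ` is coassociative:
`(a ⊗ 1 ⊗ 1)(Δ ⊗ ι)(Δ(b)(1 ⊗ c)) = (ι ⊗ Δ)((a ⊗ 1)Δ(b))(1 ⊗ 1 ⊗ c)`. -/
structure RegularMultiplierHopfAlgebra (A : Type*) [NonUnitalRing A] [Module ℂ A]
    [SMulCommClass ℂ A A] [IsScalarTower ℂ A A] where
  eq_zero_of_mul_right : ∀ a : A, (∀ b, a * b = 0) → a = 0
  eq_zero_of_mul_left : ∀ a : A, (∀ b, b * a = 0) → a = 0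
  Δ : A →ₙₐ[ℂ] Multiplier (A ⊗[ℂ] A)
  T₁ : A ⊗[ℂ] A ≃ₗ[ℂ] A ⊗[ℂ] A
  T₁_spec : ∀ a b, Multiplier.of (T₁ (a ⊗ₜ b)) = Δ a * Multiplier.tmul 1 (Multiplier.of b)
  T₂ : A ⊗[ℂ] A ≃ₗ[ℂ] A ⊗[ℂ] A
  T₂_spec : ∀ a b, Multiplier.of (T₂ (a ⊗ₜ b)) = Multiplier.tmul (Multiplier.of a) 1 * Δ b
  T₃ : A ⊗[ℂ] A ≃ₗ[ℂ] A ⊗[ℂ] A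
  T₃_spec : ∀ a b, Multiplier.of (T₃ (a ⊗ₜ b)) = Δ a * Multiplier.tmul (Multiplier.of b) 1
  T₄ : A ⊗[ℂ] A ≃ₗ[ℂ] A ⊗[ℂ] A
  T₄_spec : ∀ a b, Multiplier.of (T₄ (a ⊗ₜ b)) = Multiplier.tmul 1 (Multiplier.of a) * Δ b
  coassoc : ∀ a b c : A,
    TensorProduct.assoc ℂ A A A
        (T₂.toLinearMap.rTensor A ((TensorProduct.assoc ℂ A A A).symm (a ⊗ₜ T₁ (b ⊗ₜ c)))) =
      T₁.toLinearMap.lTensor A (TensorProduct.assoc ℂ A A A (T₂ (a ⊗ₜ b) ⊗ₜ c))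

section Slice

variable {A : Type*} [AddCommGroup A] [Module ℂ A]

/-- The slice map `f ⊗ ι : A ⊗ A → A`. -/
def sliceL (f : A →ₗ[ℂ] ℂ) : A ⊗[ℂ] A →ₗ[ℂ] A :=
  (TensorProduct.lid ℂ A).toLinearMap ∘ₗ f.rTensor A

/-- The slice map `ι ⊗ f : A ⊗ A → A`. -/
def sliceR (f : A →ₗ[ℂ] ℂ) : A ⊗[ℂ] A →ₗ[ℂ] A :=
  (TensorProduct.rid ℂ A).toLinearMap ∘ₗ f.lTensor A

@[simp] lemma sliceL_tmul (f : A →ₗ[ℂ] ℂ) (a b : A) : sliceL f (a ⊗ₜ b) = f a • b := by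
  simp [sliceL]

@[simp] lemma sliceR_tmul (f : A →ₗ[ℂ] ℂ) (a b : A) : sliceR f (a ⊗ₜ b) = f b • a := by
  simp [sliceR]

/-- A tensor all of whose slices `(ι ⊗ g) t` vanish is zero. -/
lemma tensor_eq_zero_of_slice {N : Type*} [AddCommGroup N] [Module ℂ N] (t : A ⊗[ℂ] N)
    (h : ∀ g : N →ₗ[ℂ] ℂ, TensorProduct.rid ℂ A (g.lTensor A t) = 0) : t = 0 := by
  classical
  let 𝒞 := Module.Basis.ofVectorSpace ℂ N
  apply (TensorProduct.equivFinsuppOfBasisRight (M := A) 𝒞).injective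
  ext i
  simpa [TensorProduct.equivFinsuppOfBasisRight_apply] using h (𝒞.coord i)

/-- A jointly injective family of maps on the left leg is jointly injective on tensors. -/
lemma tensor_eq_zero_of_rTensor {N X : Type*} [AddCommGroup N] [Module ℂ N]
    (f : X → A →ₗ[ℂ] A) (hf : ∀ a, (∀ x, f x a = 0) → a = 0) (t : A ⊗[ℂ] N)
    (h : ∀ x, (f x).rTensor N t = 0) : t = 0 := by
  refine tensor_eq_zero_of_slice t fun g => hf _ fun x => ?_
  have key : f x (TensorProduct.rid ℂ A (g.lTensor A t)) =
      TensorProduct.rid ℂ A (g.lTensor A ((f x).rTensor N t)) := by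
    clear h
    induction t with
    | zero => simp
    | add s t hs ht => simp only [map_add, hs, ht]
    | tmul a n => simp
  rw [key, h x]; simp

lemma tensor_eq_zero_of_lTensor {X : Type*}
    (f : X → A →ₗ[ℂ] A) (hf : ∀ a, (∀ x, f x a = 0) → a = 0) (t : A ⊗[ℂ] A)
    (h : ∀ x, (f x).lTensor A t = 0) : t = 0 := by
  apply (TensorProduct.comm ℂ A A).injective
  rw [map_zero]
  refine tensor_eq_zero_of_rTensor f hf _ fun x => ?_
  have key : (f x).rTensor A (TensorProduct.comm ℂ A A t) =
      TensorProduct.comm ℂ A A ((f x).lTensor A t) := by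
    clear h
    induction t with
    | zero => simp
    | add s t hs ht => simp only [map_add, hs, ht]
    | tmul a n => simp
  rw [key, h x, map_zero]

lemma sliceL_lTensor (f : A →ₗ[ℂ] ℂ) (g : A →ₗ[ℂ] A) (t : A ⊗[ℂ] A) :
    sliceL f (g.lTensor A t) = g (sliceL f t) := by
  induction t with
  | zero => simp
  | add s t hs ht => simp only [map_add, hs, ht]
  | tmul a n => simp

lemma sliceL_rTensor (f : A →ₗ[ℂ] ℂ) (g : A →ₗ[ℂ] A) (t : A ⊗[ℂ] A) :
    sliceL f (g.rTensor A t) = sliceL (f ∘ₗ g) t := by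
  induction t with
  | zero => simp
  | add s t hs ht => simp only [map_add, hs, ht]
  | tmul a n => simp

lemma slice_slice (f : A →ₗ[ℂ] ℂ) (t : A ⊗[ℂ] A) : f (sliceL f t) = f (sliceR f t) := by
  induction t with
  | zero => simp
  | add s t hs ht => simp only [map_add, hs, ht]
  | tmul a n => simp [mul_comm]

end Slice

/-- An algebraic quantum group: a regular multiplier Hopf algebra with a chosen left integral
`φ`, that is a non-zero linear functional with `(ι ⊗ φ)Δ(a) = φ(a)1` in `M(A)`; the two last fields
are this equality multiplied by `b` on the right and on the left. -/
structure AlgebraicQuantumGroup (A : Type*) [NonUnitalRing A] [Module ℂ A]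
    [SMulCommClass ℂ A A] [IsScalarTower ℂ A A] extends RegularMultiplierHopfAlgebra A where
  φ : A →ₗ[ℂ] ℂ
  φ_ne_zero : φ ≠ 0
  left_invariant : ∀ a b, sliceR φ (T₃ (a ⊗ₜ b)) = φ a • b
  left_invariant' : ∀ a b, sliceR φ (T₂ (b ⊗ₜ a)) = φ a • b

namespace RegularMultiplierHopfAlgebra

variable {A : Type*} [NonUnitalRing A] [Module ℂ A] [SMulCommClass ℂ A A] [IsScalarTower ℂ A A]
  (H : RegularMultiplierHopfAlgebra A)

/-- Counit: `(ε ⊗ ι)(Δ(a)(1 ⊗ b)) = ab` and `(ι ⊗ ε)((a ⊗ 1)Δ(b)) = ab`. -/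
def IsCounit (ε : A →ₗ[ℂ] ℂ) : Prop :=
  (∀ a b, sliceL ε (H.T₁ (a ⊗ₜ b)) = a * b) ∧ ∀ a b, sliceR ε (H.T₂ (a ⊗ₜ b)) = a * b

/-- The counit of a regular multiplier Hopf algebra: the unique functional with `IsCounit`. -/
noncomputable def counit : A →ₗ[ℂ] ℂ := Classical.epsilon H.IsCounit

/-- Antipode: with `m` the multiplication, `m(S ⊗ ι)(Δ(a)(1 ⊗ b)) = ε(a)b` and
`m(ι ⊗ S)((a ⊗ 1)Δ(b)) = ε(b)a`. -/
def IsAntipode (S : A ≃ₗ[ℂ] A) : Prop :=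
  (∀ a b, LinearMap.mul' ℂ A (S.toLinearMap.rTensor A (H.T₁ (a ⊗ₜ b))) = H.counit a • b) ∧
    ∀ a b, LinearMap.mul' ℂ A (S.toLinearMap.lTensor A (H.T₂ (a ⊗ₜ b))) = H.counit b • a

/-- The antipode of a regular multiplier Hopf algebra: the unique map with `IsAntipode`. -/
noncomputable def antipode : A ≃ₗ[ℂ] A := Classical.epsilon H.IsAntipode

end RegularMultiplierHopfAlgebra

/-! ### Modular element and modular automorphisms -/

section Modular

variable {A : Type*} [NonUnitalRing A] [Module ℂ A] [SMulCommClass ℂ A A] [IsScalarTower ℂ A A]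

/-- `σ` is an automorphism of the algebra `A` and `f(ab) = f(b σ(a))` for all `a, b`. -/
def IsModularAutomorphism (f : A →ₗ[ℂ] ℂ) (σ : A ≃ₗ[ℂ] A) : Prop :=
  (∀ a b, σ (a * b) = σ a * σ b) ∧ ∀ a b, f (a * b) = f (b * σ a)

/-- The modular automorphism of a functional, when there is exactly one. -/
noncomputable def modularAutomorphism (f : A →ₗ[ℂ] ℂ) : A ≃ₗ[ℂ] A :=
  Classical.epsilon (IsModularAutomorphism f)

/-- `δ` is an invertible multiplier with `f(S(a)) = f(aδ)` and `f(S⁻¹(a)) = f(δa)`. -/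
def IsModularElement (S : A ≃ₗ[ℂ] A) (f : A →ₗ[ℂ] ℂ) (δ : (Multiplier A)ˣ) : Prop :=
  ∀ a, f (S a) = f ((δ : Multiplier A).rmul a) ∧ f (S.symm a) = f ((δ : Multiplier A).lmul a)

/-- The modular element of a left integral `f` with respect to the antipode `S`. -/
noncomputable def modularElement (S : A ≃ₗ[ℂ] A) (f : A →ₗ[ℂ] ℂ) : (Multiplier A)ˣ :=
  Classical.epsilon (IsModularElement S f)

end Modular

namespace AlgebraicQuantumGroup

variable {A : Type*} [NonUnitalRing A] [Module ℂ A] [SMulCommClass ℂ A A] [IsScalarTower ℂ A A]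
  (G : AlgebraicQuantumGroup A)

/-- The counit `ε` of `A`. -/
noncomputable abbrev ε : A →ₗ[ℂ] ℂ := G.toRegularMultiplierHopfAlgebra.counit

/-- The antipode `S` of `A`. -/
noncomputable abbrev S : A ≃ₗ[ℂ] A := G.toRegularMultiplierHopfAlgebra.antipode

/-- The right integral `ψ = φ ∘ S`. -/
noncomputable def ψ : A →ₗ[ℂ] ℂ := G.φ ∘ₗ G.S.toLinearMap

/-- The modular automorphism `σ` of `φ`. -/
noncomputable def σ : A ≃ₗ[ℂ] A := modularAutomorphism G.φ

/-- The modular automorphism `σ'` of `ψ`. -/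
noncomputable def σ' : A ≃ₗ[ℂ] A := modularAutomorphism G.ψ

/-- The modular element `δ ∈ M(A)`. -/
noncomputable def δ : (Multiplier A)ˣ := modularElement G.S G.φ

/-! ### The dual algebra -/

/-- `c ↦ φ( · c)`. -/
def fourier : A →ₗ[ℂ] (A →ₗ[ℂ] ℂ) := (LinearMap.mul ℂ A).flip.compr₂ G.φ

@[simp] lemma fourier_apply (c a : A) : G.fourier c a = G.φ (a * c) := rfl

/-- The dual `B = Â`: the space of functionals `φ( · c)` with `c ∈ A`. The pairing `⟨a, b⟩` of `A`
with `B` is evaluation, `b.1 a`. -/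
def Dual : Type _ := LinearMap.range G.fourier

instance : AddCommGroup G.Dual := inferInstanceAs (AddCommGroup (LinearMap.range G.fourier))
instance : Module ℂ G.Dual := inferInstanceAs (Module ℂ (LinearMap.range G.fourier))

variable {G}

lemma Dual.ext {b b' : G.Dual} (h : ∀ a, b.1 a = b'.1 a) : b = b' :=
  Subtype.ext (LinearMap.ext h)

@[simp] lemma Dual.add_val (b b' : G.Dual) : (b + b').1 = b.1 + b'.1 := rfl
@[simp] lemma Dual.zero_val : (0 : G.Dual).1 = 0 := rfl
@[simp] lemma Dual.smul_val (r : ℂ) (b : G.Dual) : (r • b).1 = r • b.1 := rfl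

/-- An element `c` with `b = φ( · c)`. -/
noncomputable def Dual.rep (b : G.Dual) : A := b.2.choose

lemma Dual.rep_spec (b : G.Dual) (a : A) : b.1 a = G.φ (a * b.rep) :=
  (LinearMap.congr_fun b.2.choose_spec a).symm

/-- `b.actR a` is `a ◁ b = (b ⊗ ι)Δ(a) = (φ ⊗ ι)(Δ(a)(c ⊗ 1))` where `b = φ( · c)`. -/
noncomputable def Dual.actR (b : G.Dual) : A →ₗ[ℂ] A :=
  sliceL G.φ ∘ₗ G.T₃.toLinearMap ∘ₗ (TensorProduct.mk ℂ A A).flip b.rep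

/-- `b.actL a` is `b ▷ a = (ι ⊗ b)Δ(a) = (ι ⊗ φ)(Δ(a)(1 ⊗ c))` where `b = φ( · c)`. -/
noncomputable def Dual.actL (b : G.Dual) : A →ₗ[ℂ] A :=
  sliceR G.φ ∘ₗ G.T₁.toLinearMap ∘ₗ (TensorProduct.mk ℂ A A).flip b.rep

section DualProduct

variable (G)

lemma eq_zero_of_mul_tmul (G : AlgebraicQuantumGroup A) (t : A ⊗[ℂ] A) (h : ∀ x y : A, t * (x ⊗ₜ y) = 0) : t = 0 := by
  refine tensor_eq_zero_of_rTensor (fun x => (LinearMap.mul ℂ A).flip x)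
    G.eq_zero_of_mul_right t fun x => ?_
  refine tensor_eq_zero_of_lTensor (fun y => (LinearMap.mul ℂ A).flip y)
    G.eq_zero_of_mul_right _ fun y => ?_
  rw [← h x y]
  clear h
  induction t with
  | zero => simp
  | add s t hs ht => simp only [map_add, add_mul, hs, ht]
  | tmul a n => simp

lemma eq_zero_of_tmul_mul (G : AlgebraicQuantumGroup A) (t : A ⊗[ℂ] A) (h : ∀ x y : A, (x ⊗ₜ y) * t = 0) : t = 0 := by
  refine tensor_eq_zero_of_rTensor (fun x => LinearMap.mul ℂ A x)
    G.eq_zero_of_mul_left t fun x => ?_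
  refine tensor_eq_zero_of_lTensor (fun y => LinearMap.mul ℂ A y)
    G.eq_zero_of_mul_left _ fun y => ?_
  rw [← h x y]
  clear h
  induction t with
  | zero => simp
  | add s t hs ht => simp only [map_add, mul_add, hs, ht]
  | tmul a n => simp

lemma tensor_ext_mul (G : AlgebraicQuantumGroup A) {s t : A ⊗[ℂ] A} (h : ∀ x y : A, s * (x ⊗ₜ y) = t * (x ⊗ₜ y)) : s = t :=
  sub_eq_zero.1 <| G.eq_zero_of_mul_tmul _ fun x y => by rw [sub_mul, h, sub_self]

lemma lmul_mul_assoc (G : AlgebraicQuantumGroup A) (m : Multiplier (A ⊗[ℂ] A)) (s t : A ⊗[ℂ] A) :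
    m.lmul (s * t) = m.lmul s * t := by
  refine sub_eq_zero.1 <| G.eq_zero_of_tmul_mul _ fun x y => ?_
  rw [mul_sub, Multiplier.compat, ← mul_assoc (x ⊗ₜ y), Multiplier.compat, mul_assoc, sub_self]

lemma T₁_mul (a b : A) (t : A ⊗[ℂ] A) :
    G.T₁ (a ⊗ₜ b) * t = (G.Δ a).lmul ((Multiplier.tmul 1 (Multiplier.of b)).lmul t) := by
  rw [← Multiplier.lmul_mul, ← G.T₁_spec, Multiplier.lmul_of]

lemma T₂_mul (a b : A) (t : A ⊗[ℂ] A) :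
    G.T₂ (a ⊗ₜ b) * t = (Multiplier.tmul (Multiplier.of a) 1).lmul ((G.Δ b).lmul t) := by
  rw [← Multiplier.lmul_mul, ← G.T₂_spec, Multiplier.lmul_of]

lemma T₃_mul (a b : A) (t : A ⊗[ℂ] A) :
    G.T₃ (a ⊗ₜ b) * t = (G.Δ a).lmul ((Multiplier.tmul (Multiplier.of b) 1).lmul t) := by
  rw [← Multiplier.lmul_mul, ← G.T₃_spec, Multiplier.lmul_of]

lemma lTensor_mulRight_mul (e x y : A) (t : A ⊗[ℂ] A) :
    ((LinearMap.mul ℂ A).flip e).lTensor A t * (x ⊗ₜ y) = t * (x ⊗ₜ (e * y)) := by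
  induction t with
  | zero => simp
  | add s t hs ht => simp only [map_add, add_mul, hs, ht]
  | tmul a n => simp [mul_assoc]

lemma rTensor_mulRight_mul (e x y : A) (t : A ⊗[ℂ] A) :
    ((LinearMap.mul ℂ A).flip e).rTensor A t * (x ⊗ₜ y) = t * ((e * x) ⊗ₜ y) := by
  induction t with
  | zero => simp
  | add s t hs ht => simp only [map_add, add_mul, hs, ht]
  | tmul a n => simp [mul_assoc]

lemma rTensor_mulLeft_mul (e : A) (s t : A ⊗[ℂ] A) :
    (LinearMap.mul ℂ A e).rTensor A t * s =
      (Multiplier.tmul (Multiplier.of e) 1).lmul (t * s) := by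
  induction t with
  | zero => simp
  | add s t hs ht => simp only [map_add, add_mul, hs, ht]
  | tmul a n =>
    induction s with
    | zero => simp
    | add s t hs ht => simp only [map_add, mul_add, hs, ht]
    | tmul b m => simp [mul_assoc]

lemma lTensor_T₃ (a c e : A) :
    ((LinearMap.mul ℂ A).flip e).lTensor A (G.T₃ (a ⊗ₜ c)) = (G.Δ a).lmul (c ⊗ₜ e) := by
  refine G.tensor_ext_mul fun x y => ?_
  rw [lTensor_mulRight_mul, T₃_mul, ← G.lmul_mul_assoc]
  simp

lemma rTensor_T₁ (a c e : A) :
    ((LinearMap.mul ℂ A).flip c).rTensor A (G.T₁ (a ⊗ₜ e)) = (G.Δ a).lmul (c ⊗ₜ e) := by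
  refine G.tensor_ext_mul fun x y => ?_
  rw [rTensor_mulRight_mul, T₁_mul, ← G.lmul_mul_assoc]
  simp

lemma rTensor_T₂ (a c e : A) :
    ((LinearMap.mul ℂ A).flip c).rTensor A (G.T₂ (e ⊗ₜ a)) =
      (LinearMap.mul ℂ A e).rTensor A (G.T₃ (a ⊗ₜ c)) := by
  refine G.tensor_ext_mul fun x y => ?_
  rw [rTensor_mulRight_mul, T₂_mul, rTensor_mulLeft_mul, T₃_mul]
  simp

lemma lmul_T₃ (a : A) (p q : A) : (G.Δ a).lmul (G.T₃ (p ⊗ₜ q)) = G.T₃ ((a * p) ⊗ₜ q) := by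
  refine G.tensor_ext_mul fun x y => ?_
  rw [← G.lmul_mul_assoc, T₃_mul, T₃_mul, map_mul, Multiplier.lmul_mul]

variable {G}

/-- `(a ◁ b) e = (b ⊗ ι)(Δ(a)(1 ⊗ e))`. -/
lemma Dual.actR_mul (b : G.Dual) (a e : A) : b.actR a * e = sliceL b.1 (G.T₁ (a ⊗ₜ e)) := by
  have h : b.1 = G.φ ∘ₗ (LinearMap.mul ℂ A).flip b.rep := LinearMap.ext fun x => b.rep_spec x
  rw [h, ← sliceL_rTensor, rTensor_T₁, ← lTensor_T₃, sliceL_lTensor]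
  rfl

lemma Dual.mul_mem (b b' : G.Dual) : b'.1 ∘ₗ b.actR ∈ LinearMap.range G.fourier := by
  refine ⟨sliceR G.φ (G.T₃.symm (b.rep ⊗ₜ b'.rep)), LinearMap.ext fun a => ?_⟩
  have h : b'.1 (b.actR a) = G.φ (sliceL G.φ ((G.Δ a).lmul (b.rep ⊗ₜ b'.rep))) := by
    rw [b'.rep_spec, ← lTensor_T₃, sliceL_lTensor]; rfl
  rw [fourier_apply, LinearMap.comp_apply, h]
  obtain ⟨s, hs⟩ := G.T₃.surjective (b.rep ⊗ₜ b'.rep)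
  rw [← hs, LinearEquiv.symm_apply_apply]
  clear hs h
  induction s with
  | zero => simp
  | add s t hs ht => simp only [map_add, mul_add, hs, ht]
  | tmul p q => rw [lmul_T₃, slice_slice, G.left_invariant]; simp [mul_comm, mul_smul_comm]

/-- The product of `B`: `⟨a, bb'⟩ = ⟨a ◁ b, b'⟩ = ⟨Δ(a), b ⊗ b'⟩`. -/
noncomputable instance : Mul G.Dual := ⟨fun b b' => ⟨b'.1 ∘ₗ b.actR, Dual.mul_mem b b'⟩⟩

lemma Dual.mul_val (b b' : G.Dual) (a : A) : (b * b').1 a = b'.1 (b.actR a) := rfl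

lemma Dual.rTensor_actR (b : G.Dual) (a e : A) :
    b.actR.rTensor A (G.T₁ (a ⊗ₜ e)) = G.T₁ (b.actR a ⊗ₜ e) := by
  let P : A →ₗ[ℂ] A ⊗[ℂ] A := G.T₃.toLinearMap ∘ₗ (TensorProduct.mk ℂ A A).flip b.rep
  have key : TensorProduct.assoc ℂ A A A (P.rTensor A (G.T₁ (a ⊗ₜ e))) =
      G.T₁.toLinearMap.lTensor A (TensorProduct.assoc ℂ A A A (G.T₃ (a ⊗ₜ b.rep) ⊗ₜ e)) := by
    refine sub_eq_zero.1 <| tensor_eq_zero_of_rTensor (fun x => LinearMap.mul ℂ A x)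
      G.eq_zero_of_mul_left _ fun x => ?_
    rw [map_sub, sub_eq_zero]
    have h := congrArg (((LinearMap.mul ℂ A).flip b.rep).rTensor (A ⊗[ℂ] A)) (G.coassoc x a e)
    have h1 : ∀ t : A ⊗[ℂ] A, ((LinearMap.mul ℂ A).flip b.rep).rTensor (A ⊗[ℂ] A)
        (TensorProduct.assoc ℂ A A A (G.T₂.toLinearMap.rTensor A
          ((TensorProduct.assoc ℂ A A A).symm (x ⊗ₜ t)))) =
        (LinearMap.mul ℂ A x).rTensor (A ⊗[ℂ] A)
          (TensorProduct.assoc ℂ A A A (P.rTensor A t)) := by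
      intro t
      induction t with
      | zero => simp
      | add s t hs ht => simp only [TensorProduct.tmul_add, map_add, hs, ht]
      | tmul p q =>
        have hh : ∀ (g : A →ₗ[ℂ] A) (u : A ⊗[ℂ] A),
            g.rTensor (A ⊗[ℂ] A) (TensorProduct.assoc ℂ A A A (u ⊗ₜ q)) =
              TensorProduct.assoc ℂ A A A (g.rTensor A u ⊗ₜ q) := by
          intro g u
          induction u with
          | zero => simp
          | add s t hs ht => simp only [TensorProduct.add_tmul, map_add, hs, ht]
          | tmul p q => simp
        simp only [TensorProduct.assoc_symm_tmul, LinearMap.rTensor_tmul, LinearEquiv.coe_coe]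
        rw [hh, hh, rTensor_T₂]
        rfl
    have h2 : ∀ (g : A →ₗ[ℂ] A) (u : A ⊗[ℂ] A), g.rTensor (A ⊗[ℂ] A)
        (G.T₁.toLinearMap.lTensor A (TensorProduct.assoc ℂ A A A (u ⊗ₜ e))) =
        G.T₁.toLinearMap.lTensor A (TensorProduct.assoc ℂ A A A (g.rTensor A u ⊗ₜ e)) := by
      intro g u
      induction u with
      | zero => simp
      | add s t hs ht => simp only [TensorProduct.add_tmul, map_add, hs, ht]
      | tmul p q => simp
    rw [h1, h2, rTensor_T₂, ← h2] at h
    exact h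
  have key' := congrArg
    (fun u => TensorProduct.lid ℂ (A ⊗[ℂ] A) (G.φ.rTensor (A ⊗[ℂ] A) u)) key
  have h3 : ∀ t : A ⊗[ℂ] A, TensorProduct.lid ℂ (A ⊗[ℂ] A) (G.φ.rTensor (A ⊗[ℂ] A)
      (TensorProduct.assoc ℂ A A A (P.rTensor A t))) = b.actR.rTensor A t := by
    intro t
    induction t with
    | zero => simp
    | add s t hs ht => simp only [map_add, hs, ht]
    | tmul p q =>
      have hh : ∀ u : A ⊗[ℂ] A, TensorProduct.lid ℂ (A ⊗[ℂ] A) (G.φ.rTensor (A ⊗[ℂ] A)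
          (TensorProduct.assoc ℂ A A A (u ⊗ₜ q))) = sliceL G.φ u ⊗ₜ q := by
        intro u
        induction u with
        | zero => simp
        | add s t hs ht => simp only [TensorProduct.add_tmul, map_add, hs, ht]
        | tmul p q => simp [TensorProduct.smul_tmul']
      rw [LinearMap.rTensor_tmul, hh]
      rfl
  have h4 : ∀ u : A ⊗[ℂ] A, TensorProduct.lid ℂ (A ⊗[ℂ] A) (G.φ.rTensor (A ⊗[ℂ] A)
      (G.T₁.toLinearMap.lTensor A (TensorProduct.assoc ℂ A A A (u ⊗ₜ e)))) =
      G.T₁ (sliceL G.φ u ⊗ₜ e) := by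
    intro u
    induction u with
    | zero => simp
    | add s t hs ht => simp only [TensorProduct.add_tmul, map_add, hs, ht]
    | tmul p q => simp [← TensorProduct.smul_tmul']
  simp only [h3, h4] at key'
  exact key'

lemma ext_mul (G : AlgebraicQuantumGroup A) {x y : A} (h : ∀ e, x * e = y * e) : x = y :=
  sub_eq_zero.1 <| G.eq_zero_of_mul_right _ fun e => by rw [sub_mul, h, sub_self]

lemma Dual.actR_actR (b b' : G.Dual) (a : A) : (b * b').actR a = b'.actR (b.actR a) := by
  refine ext_mul G fun e => ?_
  rw [actR_mul, actR_mul, ← rTensor_actR, sliceL_rTensor]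
  rfl

lemma Dual.actR_add (b b' : G.Dual) (a : A) : (b + b').actR a = b.actR a + b'.actR a := by
  refine ext_mul G fun e => ?_
  rw [add_mul, actR_mul, actR_mul, actR_mul]
  simp [sliceL, LinearMap.rTensor_add]

lemma Dual.actR_smul (r : ℂ) (b : G.Dual) (a : A) : (r • b).actR a = r • b.actR a := by
  refine ext_mul G fun e => ?_
  rw [smul_mul_assoc, actR_mul, actR_mul]
  simp [sliceL, LinearMap.rTensor_smul]

lemma Dual.actR_zero (a : A) : (0 : G.Dual).actR a = 0 := by
  simpa using Dual.actR_smul 0 (0 : G.Dual) a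

noncomputable instance : NonUnitalRing G.Dual where
  left_distrib b b' b'' := Dual.ext fun a => by simp [Dual.mul_val]
  right_distrib b b' b'' := Dual.ext fun a => by simp [Dual.mul_val, Dual.actR_add]
  zero_mul b := Dual.ext fun a => by simp [Dual.mul_val, Dual.actR_zero]
  mul_zero b := Dual.ext fun a => by simp [Dual.mul_val]
  mul_assoc b b' b'' := Dual.ext fun a => by simp [Dual.mul_val, Dual.actR_actR]

instance : SMulCommClass ℂ G.Dual G.Dual :=
  ⟨fun r b b' => Dual.ext fun a => by simp [Dual.mul_val]⟩

instance : IsScalarTower ℂ G.Dual G.Dual :=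
  ⟨fun r b b' => Dual.ext fun a => by simp [Dual.mul_val, Dual.actR_smul]⟩

end DualProduct

/-! ### The objects of the dual -/

/-- `F` is the functional `⟨ · , m⟩` on `A`, for `m ∈ M(B)`:
`⟨a ◁ b, m⟩ = ⟨a, bm⟩` and `⟨b ▷ a, m⟩ = ⟨a, mb⟩`. -/
def IsExtendedPairing (G : AlgebraicQuantumGroup A) (m : Multiplier G.Dual) (F : A →ₗ[ℂ] ℂ) : Prop :=
  (∀ (a : A) (b : G.Dual), F (b.actR a) = (m.rmul b).1 a) ∧
    ∀ (a : A) (b : G.Dual), F (b.actL a) = (m.lmul b).1 a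

variable (G)

/-- The extended pairing of `A` with `M(B)`: `G.pairing m a` is `⟨a, m⟩`. -/
noncomputable def pairing (m : Multiplier G.Dual) : A →ₗ[ℂ] ℂ :=
  Classical.epsilon (G.IsExtendedPairing m)

/-- Defining property of `ψ̂`: `ψ̂(b) = ε(c)` if `b = φ( · c)`. -/
def IsDualPsi (f : G.Dual →ₗ[ℂ] ℂ) : Prop :=
  ∀ (c : A) (b : G.Dual), (∀ x, b.1 x = G.φ (x * c)) → f b = G.ε c

/-- Defining property of `φ̂`: `φ̂(b) = ε(c)` if `b = ψ(S( · )c)`. -/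
def IsDualPhi (f : G.Dual →ₗ[ℂ] ℂ) : Prop :=
  ∀ (c : A) (b : G.Dual), (∀ x, b.1 x = G.ψ (G.S x * c)) → f b = G.ε c

/-- The right integral `ψ̂` on `B`. -/
noncomputable def dualψ : G.Dual →ₗ[ℂ] ℂ := Classical.epsilon G.IsDualPsi

/-- The left integral `φ̂` on `B`. -/
noncomputable def dualφ : G.Dual →ₗ[ℂ] ℂ := Classical.epsilon G.IsDualPhi

/-- The antipode of `B` is the adjoint of the antipode of `A`: `⟨a, S(b)⟩ = ⟨S(a), b⟩`. -/
def IsDualAntipode (T : G.Dual ≃ₗ[ℂ] G.Dual) : Prop :=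
  ∀ (b : G.Dual) (a : A), (T b).1 a = b.1 (G.S a)

/-- The antipode of `B`. -/
noncomputable def dualS : G.Dual ≃ₗ[ℂ] G.Dual := Classical.epsilon G.IsDualAntipode

/-- The modular automorphism `σ̂` of `φ̂`. -/
noncomputable def dualσ : G.Dual ≃ₗ[ℂ] G.Dual := modularAutomorphism G.dualφ

/-- The modular automorphism `σ̂'` of `ψ̂`. -/
noncomputable def dualσ' : G.Dual ≃ₗ[ℂ] G.Dual := modularAutomorphism G.dualψ

/-- The modular element `δ̂ ∈ M(B)`. -/
noncomputable def dualδ : (Multiplier G.Dual)ˣ := modularElement G.dualS G.dualφ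

end AlgebraicQuantumGroup

/-! ### Slice maps and separation of tensors -/

section SliceLemmas

variable {A : Type*} [AddCommGroup A] [Module ℂ A]

/-! Every formula on the dual becomes a computation on `A` through the Fourier transform `G.F : c ↦
φ(· c)`, which is a bijection because `φ` is faithful. The inputs are the structure theory of `A`
and one character, `χ = ε ∘ σ⁻¹`.

For the structure theory, invariance gives the key identity S((ι ⊗ φ)(Δ(a)(1 ⊗ b))) = (ι ⊗ φ)((1 ⊗
a)Δ(b)) (`IsLeftInvariant.S_sliceR_T₁`). It constructs the antipode, shows that it reverses the
coproduct, and yields faithfulness and uniqueness of `φ`. The modular automorphisms exist because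
the spaces of functionals φ(· c), φ(c ·), ψ(· c), ψ(c ·) coincide. The modular element exists
because (φ ⊗ ι)Δ(a), paired with any functional, is left invariant in a, hence proportional to φ(a).

The same identity gives Δ(σ(a)) = (S² ⊗ σ)Δ(a), and its mirror image Δ(σ'⁻¹(a)) = (σ'⁻¹ ⊗ S²)Δ(a).
Therefore (ι ⊗ χ)Δ = S²σ⁻¹ and, because ε ∘ σ'⁻¹ = χ, also (χ ⊗ ι)Δ = S⁻²σ'⁻¹. The two sides of the
multiplier of the dual defined by `χ` are thus explicit bijections, and in the Fourier picture this
multiplier satisfies the defining relations of the dual modular element, which are shown to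
determine it. This is part 1 (`isExtendedPairing_dualδ`, `isExtendedPairing_dualδ_inv`, `dualδ_eq`).

Part 3 (`dualψ_F_mul_F`) comes from writing c ⊗ c' as a combination of elements Δ(p)(q ⊗ 1), which
turns the convolution product into a slice by `φ` and the dual integral into the antipode axiom.
Part 2 follows: by the Plancherel formula, the modular automorphism of the dual right integral sends
φ(· c) to φ(· S²(c)δ⁻¹) (`dualψ_mul_comm`), and conjugating the inverse by the dual antipode handles
the left integral. -/

lemma sliceR_lTensor (f : A →ₗ[ℂ] ℂ) (g : A →ₗ[ℂ] A) (t : A ⊗[ℂ] A) :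
    sliceR f (g.lTensor A t) = sliceR (f ∘ₗ g) t := by
  induction t with
  | zero => simp
  | add s t hs ht => simp only [map_add, hs, ht]
  | tmul a n => simp

lemma sliceR_rTensor (f : A →ₗ[ℂ] ℂ) (g : A →ₗ[ℂ] A) (t : A ⊗[ℂ] A) :
    sliceR f (g.rTensor A t) = g (sliceR f t) := by
  induction t with
  | zero => simp
  | add s t hs ht => simp only [map_add, hs, ht]
  | tmul a n => simp

lemma sliceL_comm (f : A →ₗ[ℂ] ℂ) (t : A ⊗[ℂ] A) :
    sliceL f (TensorProduct.comm ℂ A A t) = sliceR f t := by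
  induction t with
  | zero => simp
  | add s t hs ht => simp only [map_add, hs, ht]
  | tmul a n => simp

lemma sliceR_comm (f : A →ₗ[ℂ] ℂ) (t : A ⊗[ℂ] A) :
    sliceR f (TensorProduct.comm ℂ A A t) = sliceL f t := by
  induction t with
  | zero => simp
  | add s t hs ht => simp only [map_add, hs, ht]
  | tmul a n => simp

lemma apply_sliceL (f g : A →ₗ[ℂ] ℂ) (t : A ⊗[ℂ] A) : g (sliceL f t) = f (sliceR g t) := by
  induction t with
  | zero => simp
  | add s t hs ht => simp only [map_add, hs, ht]
  | tmul a n => simp [mul_comm]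

lemma sliceL_map (f : A →ₗ[ℂ] ℂ) (g h : A →ₗ[ℂ] A) (t : A ⊗[ℂ] A) :
    sliceL f (TensorProduct.map g h t) = h (sliceL (f ∘ₗ g) t) := by
  induction t with
  | zero => simp
  | add s t hs ht => simp only [map_add, hs, ht]
  | tmul a n => simp

lemma sliceR_map (f : A →ₗ[ℂ] ℂ) (g h : A →ₗ[ℂ] A) (t : A ⊗[ℂ] A) :
    sliceR f (TensorProduct.map g h t) = g (sliceR (f ∘ₗ h) t) := by
  induction t with
  | zero => simp
  | add s t hs ht => simp only [map_add, hs, ht]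
  | tmul a n => simp

lemma lTensor_smulRight (f : A →ₗ[ℂ] ℂ) (q : A) (t : A ⊗[ℂ] A) :
    (f.smulRight q).lTensor A t = sliceR f t ⊗ₜ q := by
  induction t with
  | zero => simp
  | add s t hs ht => simp only [map_add, TensorProduct.add_tmul, hs, ht]
  | tmul a n => simp [TensorProduct.smul_tmul']

lemma sliceL_surjective {f : A →ₗ[ℂ] ℂ} (hf : f ≠ 0) : Function.Surjective (sliceL f) := by
  obtain ⟨a, ha⟩ : ∃ a, f a ≠ 0 := by
    by_contra! h
    exact hf (LinearMap.ext h)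
  exact fun x => ⟨((f a)⁻¹ • a) ⊗ₜ x, by simp [ha]⟩

lemma sliceR_surjective {f : A →ₗ[ℂ] ℂ} (hf : f ≠ 0) : Function.Surjective (sliceR f) := by
  obtain ⟨a, ha⟩ : ∃ a, f a ≠ 0 := by
    by_contra! h
    exact hf (LinearMap.ext h)
  exact fun x => ⟨x ⊗ₜ ((f a)⁻¹ • a), by simp [ha]⟩

lemma tensor_eq_of_sliceR {X : Type*} (f : X → A →ₗ[ℂ] ℂ) (hf : ∀ a, (∀ x, f x a = 0) → a = 0)
    {s t : A ⊗[ℂ] A} (h : ∀ x, sliceR (f x) s = sliceR (f x) t) : s = t := by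
  rw [← sub_eq_zero]
  apply (TensorProduct.comm ℂ A A).injective
  rw [map_zero]
  refine tensor_eq_zero_of_slice _ fun g => hf _ fun x => ?_
  change f x (sliceR g (TensorProduct.comm ℂ A A (s - t))) = 0
  rw [sliceR_comm, apply_sliceL, map_sub, h, sub_self, map_zero]

/-- A jointly injective family of maps on the right leg is jointly injective on tensors. -/
lemma tensor_eq_zero_of_lTensor' {N X : Type*} [AddCommGroup N] [Module ℂ N]
    (f : X → A →ₗ[ℂ] A) (hf : ∀ a, (∀ x, f x a = 0) → a = 0) (t : N ⊗[ℂ] A)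
    (h : ∀ x, (f x).lTensor N t = 0) : t = 0 := by
  apply (TensorProduct.comm ℂ N A).injective
  rw [map_zero]
  refine tensor_eq_zero_of_rTensor f hf _ fun x => ?_
  have key : (f x).rTensor N (TensorProduct.comm ℂ N A t) =
      TensorProduct.comm ℂ N A ((f x).lTensor N t) := by
    clear h
    induction t with
    | zero => simp
    | add s t hs ht => simp only [map_add, hs, ht]
    | tmul a n => simp
  rw [key, h x, map_zero]

end SliceLemmas

/-! ### Isomorphisms from equal kernels or equal ranges -/

section LinearAlgebra

/-- Two surjections with the same kernel differ by an isomorphism of their targets. -/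
lemma exists_linearEquiv_of_ker_eq {V A B : Type*} [AddCommGroup V] [Module ℂ V] [AddCommGroup A]
    [Module ℂ A] [AddCommGroup B] [Module ℂ B] (p : V →ₗ[ℂ] A) (q : V →ₗ[ℂ] B)
    (hp : Function.Surjective p) (hq : Function.Surjective q)
    (h : LinearMap.ker p = LinearMap.ker q) : ∃ e : A ≃ₗ[ℂ] B, ∀ v, e (p v) = q v := by
  refine ⟨(p.quotKerEquivOfSurjective hp).symm ≪≫ₗ Submodule.quotEquivOfEq _ _ h ≪≫ₗ
    q.quotKerEquivOfSurjective hq, fun v => ?_⟩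
  have : (p.quotKerEquivOfSurjective hp).symm (p v) = Submodule.Quotient.mk v := by
    rw [LinearEquiv.symm_apply_eq]; rfl
  simp only [LinearEquiv.trans_apply, this]
  rfl

/-- Two injections with the same range differ by an isomorphism of their sources. -/
lemma exists_linearEquiv_of_range_eq {V A B : Type*} [AddCommGroup V] [Module ℂ V] [AddCommGroup A]
    [Module ℂ A] [AddCommGroup B] [Module ℂ B] (p : A →ₗ[ℂ] V) (q : B →ₗ[ℂ] V)
    (hp : Function.Injective p) (hq : Function.Injective q)
    (h : LinearMap.range p = LinearMap.range q) : ∃ e : A ≃ₗ[ℂ] B, ∀ v, q (e v) = p v := by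
  refine ⟨LinearEquiv.ofInjective p hp ≪≫ₗ LinearEquiv.ofEq _ _ h ≪≫ₗ
    (LinearEquiv.ofInjective q hq).symm, fun v => ?_⟩
  have := LinearEquiv.apply_symm_apply (LinearEquiv.ofInjective q hq)
    (LinearEquiv.ofEq _ _ h (LinearEquiv.ofInjective p hp v))
  exact congrArg Subtype.val this

lemma range_eq_of_comp_eq {U V A B : Type*} [AddCommGroup V] [Module ℂ V] [AddCommGroup A]
    [Module ℂ A] [AddCommGroup B] [Module ℂ B] [AddCommGroup U] [Module ℂ U]
    (p : A →ₗ[ℂ] V) (q : B →ₗ[ℂ] V) (u : U →ₗ[ℂ] A) (v : U →ₗ[ℂ] B)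
    (hu : Function.Surjective u) (hv : Function.Surjective v) (h : p ∘ₗ u = q ∘ₗ v) :
    LinearMap.range p = LinearMap.range q := by
  rw [← LinearMap.range_comp_of_range_eq_top p (LinearMap.range_eq_top.2 hu), h,
    LinearMap.range_comp_of_range_eq_top q (LinearMap.range_eq_top.2 hv)]

end LinearAlgebra

section Mul

variable {A : Type*} [NonUnitalRing A] [Module ℂ A] [SMulCommClass ℂ A A] [IsScalarTower ℂ A A]

/-- Left multiplication by `e`. -/
abbrev mulL (e : A) : A →ₗ[ℂ] A := LinearMap.mul ℂ A e

/-- Right multiplication by `e`. -/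
abbrev mulR (e : A) : A →ₗ[ℂ] A := (LinearMap.mul ℂ A).flip e

end Mul

namespace AlgebraicQuantumGroup

variable {A : Type*} [NonUnitalRing A] [Module ℂ A] [SMulCommClass ℂ A A] [IsScalarTower ℂ A A]
  (G : AlgebraicQuantumGroup A)

/-! ### Relations between the canonical maps -/

lemma T₄_mul (a b : A) (t : A ⊗[ℂ] A) :
    G.T₄ (a ⊗ₜ b) * t = (Multiplier.tmul 1 (Multiplier.of a)).lmul ((G.Δ b).lmul t) := by
  rw [← Multiplier.lmul_mul, ← G.T₄_spec, Multiplier.lmul_of]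

lemma lTensor_mulLeft_mul (e : A) (s t : A ⊗[ℂ] A) :
    (mulL e).lTensor A t * s = (Multiplier.tmul 1 (Multiplier.of e)).lmul (t * s) := by
  induction t with
  | zero => simp
  | add s t hs ht => simp only [map_add, add_mul, hs, ht]
  | tmul a n =>
    induction s with
    | zero => simp
    | add s t hs ht => simp only [map_add, mul_add, hs, ht]
    | tmul b m => simp [mul_assoc]

/-- Both sides are (e ⊗ 1)Δ(a)(1 ⊗ c). This and its variants move the factor that brings Δ(a) into A
⊗ A from one place to another. -/
lemma lTensor_T₂ (a c e : A) :
    (mulR c).lTensor A (G.T₂ (e ⊗ₜ a)) = (mulL e).rTensor A (G.T₁ (a ⊗ₜ c)) := by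
  refine G.tensor_ext_mul fun x y => ?_
  rw [lTensor_mulRight_mul, T₂_mul, rTensor_mulLeft_mul, T₁_mul]
  simp

lemma lTensor_T₄ (a c e : A) :
    (mulR c).lTensor A (G.T₄ (e ⊗ₜ a)) = (mulL e).lTensor A (G.T₁ (a ⊗ₜ c)) := by
  refine G.tensor_ext_mul fun x y => ?_
  rw [lTensor_mulRight_mul, T₄_mul, lTensor_mulLeft_mul, T₁_mul]
  simp

lemma rTensor_T₄ (a c e : A) :
    (mulR c).rTensor A (G.T₄ (e ⊗ₜ a)) = (mulL e).lTensor A (G.T₃ (a ⊗ₜ c)) := by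
  refine G.tensor_ext_mul fun x y => ?_
  rw [rTensor_mulRight_mul, T₄_mul, lTensor_mulLeft_mul, T₃_mul]
  simp

lemma lTensor_mulL_T₂ (a d e : A) :
    (mulL e).lTensor A (G.T₂ (d ⊗ₜ a)) = (mulL d).rTensor A (G.T₄ (e ⊗ₜ a)) := by
  refine G.tensor_ext_mul fun x y => ?_
  rw [lTensor_mulLeft_mul, T₂_mul, rTensor_mulLeft_mul, T₄_mul]
  generalize (G.Δ a).lmul (x ⊗ₜ[ℂ] y) = s
  induction s with
  | zero => simp
  | add s t hs ht => simp only [map_add, hs, ht]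
  | tmul b m => simp

lemma rTensor_T₁_eq_lTensor_T₃ (a c e : A) :
    (mulR c).rTensor A (G.T₁ (a ⊗ₜ e)) = (mulR e).lTensor A (G.T₃ (a ⊗ₜ c)) := by
  rw [rTensor_T₁, lTensor_T₃]

lemma eq_of_rTensor_mulL (G : AlgebraicQuantumGroup A) {s t : A ⊗[ℂ] A}
    (h : ∀ x, (mulL x).rTensor A s = (mulL x).rTensor A t) : s = t :=
  sub_eq_zero.1 <| tensor_eq_zero_of_rTensor mulL G.eq_zero_of_mul_left _ fun x => by
    rw [map_sub, h, sub_self]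

lemma eq_of_rTensor_mulR (G : AlgebraicQuantumGroup A) {s t : A ⊗[ℂ] A}
    (h : ∀ x, (mulR x).rTensor A s = (mulR x).rTensor A t) : s = t :=
  sub_eq_zero.1 <| tensor_eq_zero_of_rTensor mulR G.eq_zero_of_mul_right _ fun x => by
    rw [map_sub, h, sub_self]

lemma eq_of_lTensor_mulL (G : AlgebraicQuantumGroup A) {s t : A ⊗[ℂ] A}
    (h : ∀ x, (mulL x).lTensor A s = (mulL x).lTensor A t) : s = t :=
  sub_eq_zero.1 <| tensor_eq_zero_of_lTensor mulL G.eq_zero_of_mul_left _ fun x => by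
    rw [map_sub, h, sub_self]

lemma ext_mul_left (G : AlgebraicQuantumGroup A) {x y : A} (h : ∀ e, e * x = e * y) : x = y :=
  sub_eq_zero.1 <| G.eq_zero_of_mul_left _ fun e => by rw [mul_sub, h, sub_self]

lemma lmul_T₁ (a : A) (p q : A) : (G.Δ a).lmul (G.T₁ (p ⊗ₜ q)) = G.T₁ ((a * p) ⊗ₜ q) := by
  refine G.tensor_ext_mul fun x y => ?_
  rw [← G.lmul_mul_assoc, T₁_mul, T₁_mul, map_mul, Multiplier.lmul_mul]

lemma rmul_mul_assoc (G : AlgebraicQuantumGroup A) (m : Multiplier (A ⊗[ℂ] A)) (s t : A ⊗[ℂ] A) :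
    m.rmul (s * t) = s * m.rmul t := by
  refine sub_eq_zero.1 <| G.eq_zero_of_mul_tmul _ fun x y => ?_
  rw [sub_mul, ← Multiplier.compat, mul_assoc, mul_assoc, ← Multiplier.compat, sub_self]

lemma mul_T₂ (a b : A) (t : A ⊗[ℂ] A) :
    t * G.T₂ (a ⊗ₜ b) = (G.Δ b).rmul ((mulR a).rTensor A t) := by
  have h := congrArg (fun m => m.rmul t) (G.T₂_spec a b)
  have h2 : (Multiplier.tmul (Multiplier.of a) 1).rmul t = (mulR a).rTensor A t := by
    clear h
    induction t with
    | zero => simp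
    | add s t hs ht => simp only [map_add, hs, ht]
    | tmul p q => rfl
  rw [← h2]
  exact h

lemma rmul_T₂ (a p q : A) : (G.Δ a).rmul (G.T₂ (p ⊗ₜ q)) = G.T₂ (p ⊗ₜ (q * a)) := by
  refine sub_eq_zero.1 <| G.eq_zero_of_tmul_mul _ fun x y => ?_
  rw [mul_sub, ← G.rmul_mul_assoc, mul_T₂, mul_T₂, map_mul, sub_eq_zero]
  rfl

lemma rmul_tmul (a x y : A) : (G.Δ a).rmul (x ⊗ₜ y) = (mulL y).lTensor A (G.T₂ (x ⊗ₜ a)) := by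
  refine sub_eq_zero.1 <| G.eq_zero_of_mul_tmul _ fun p q => ?_
  rw [sub_mul, ← Multiplier.compat, lTensor_mulLeft_mul, T₂_mul, sub_eq_zero]
  generalize (G.Δ a).lmul (p ⊗ₜ[ℂ] q) = s
  induction s with
  | zero => simp
  | add s t hs ht => simp only [map_add, mul_add, hs, ht]
  | tmul b m => simp

lemma lmul_tmul (a x y : A) : (G.Δ a).lmul (x ⊗ₜ y) = (mulR x).rTensor A (G.T₁ (a ⊗ₜ y)) :=
  (G.rTensor_T₁ a x y).symm

end AlgebraicQuantumGroup

namespace AlgebraicQuantumGroup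

variable {A : Type*} [NonUnitalRing A] [Module ℂ A] [SMulCommClass ℂ A A] [IsScalarTower ℂ A A]
  (G : AlgebraicQuantumGroup A)

/-! ### Coassociativity -/

/-- `r ⊗ s ↦ (x ⊗ 1)Δ(r) ⊗ s`. -/
def T₂Leg (x : A) : A ⊗[ℂ] A →ₗ[ℂ] A ⊗[ℂ] (A ⊗[ℂ] A) :=
  (TensorProduct.assoc ℂ A A A).toLinearMap ∘ₗ
    (G.T₂.toLinearMap ∘ₗ TensorProduct.mk ℂ A A x).rTensor A

lemma T₂Leg_tmul (x r s : A) :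
    G.T₂Leg x (r ⊗ₜ s) = TensorProduct.assoc ℂ A A A (G.T₂ (x ⊗ₜ r) ⊗ₜ s) := by
  simp [T₂Leg]

lemma T₂Leg_eq (x : A) (t : A ⊗[ℂ] A) :
    G.T₂Leg x t = TensorProduct.assoc ℂ A A A
      (G.T₂.toLinearMap.rTensor A ((TensorProduct.assoc ℂ A A A).symm (x ⊗ₜ t))) := by
  induction t with
  | zero => simp
  | add s t hs ht => simp only [map_add, TensorProduct.tmul_add, hs, ht]
  | tmul r s => simp [T₂Leg_tmul]

/-- The form in which coassociativity is used: any slice of the second or third leg can now be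
applied to both sides. -/
lemma T₂Leg_T₁ (x : A) (t : A ⊗[ℂ] A) :
    G.T₂Leg x (G.T₁ t) = G.T₁.toLinearMap.lTensor A (G.T₂Leg x t) := by
  induction t with
  | zero => simp
  | add s t hs ht => simp only [map_add, hs, ht]
  | tmul r s => rw [T₂Leg_eq, G.coassoc, T₂Leg_tmul]

lemma T₂Leg_T₁_symm (x : A) (t : A ⊗[ℂ] A) :
    G.T₂Leg x (G.T₁.symm t) = G.T₁.symm.toLinearMap.lTensor A (G.T₂Leg x t) := by
  obtain ⟨t, rfl⟩ := G.T₁.surjective t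
  rw [T₂Leg_T₁, ← LinearMap.comp_apply, ← LinearMap.lTensor_comp]
  simp

lemma lTensor_assoc {A N : Type*} [AddCommGroup A] [Module ℂ A] [AddCommGroup N] [Module ℂ N]
    (F : A ⊗[ℂ] A →ₗ[ℂ] N)
    (t : A ⊗[ℂ] A) (s : A) : F.lTensor A (TensorProduct.assoc ℂ A A A (t ⊗ₜ s)) =
      (F ∘ₗ (TensorProduct.mk ℂ A A).flip s).lTensor A t := by
  induction t with
  | zero => simp
  | add s t hs ht => simp only [map_add, TensorProduct.add_tmul, hs, ht]
  | tmul p q => simp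

lemma lTensor_T₂Leg {N : Type*} [AddCommGroup N] [Module ℂ N] (F : A ⊗[ℂ] A →ₗ[ℂ] N)
    (x r s : A) : F.lTensor A (G.T₂Leg x (r ⊗ₜ s)) =
      (F ∘ₗ (TensorProduct.mk ℂ A A).flip s).lTensor A (G.T₂ (x ⊗ₜ r)) := by
  rw [T₂Leg_tmul, lTensor_assoc]

/-- `(ι ⊗ ι ⊗ f)` after `(x ⊗ 1 ⊗ 1)(Δ ⊗ ι)`. -/
lemma lTensor_sliceR_T₂Leg (f : A →ₗ[ℂ] ℂ) (x : A) (t : A ⊗[ℂ] A) :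
    (sliceR f).lTensor A (G.T₂Leg x t) = G.T₂ (x ⊗ₜ sliceR f t) := by
  induction t with
  | zero => simp
  | add s t hs ht => simp only [map_add, TensorProduct.tmul_add, hs, ht]
  | tmul r s =>
    have : sliceR f ∘ₗ (TensorProduct.mk ℂ A A).flip s = f s • LinearMap.id := by
      ext; simp
    rw [lTensor_T₂Leg, this]
    simp [LinearMap.lTensor_smul]

/-- `(ι ⊗ f ⊗ ι)` after `(x ⊗ 1 ⊗ 1)(Δ ⊗ ι)`. -/
lemma lTensor_sliceL_T₂Leg (f : A →ₗ[ℂ] ℂ) (x : A) (t : A ⊗[ℂ] A) :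
    (sliceL f).lTensor A (G.T₂Leg x t) =
      (sliceR f ∘ₗ G.T₂.toLinearMap ∘ₗ TensorProduct.mk ℂ A A x).rTensor A t := by
  induction t with
  | zero => simp
  | add s t hs ht => simp only [map_add, hs, ht]
  | tmul r s =>
    have : sliceL f ∘ₗ (TensorProduct.mk ℂ A A).flip s = f.smulRight s := by
      ext; simp
    rw [lTensor_T₂Leg, this, lTensor_smulRight]
    simp

/-- The operators `(ι ⊗ f(· z))Δ` commute with the left leg of `Δ`. -/
lemma T₂_sliceR_T₁ (f : A →ₗ[ℂ] ℂ) (x a z : A) :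
    G.T₂ (x ⊗ₜ sliceR f (G.T₁ (a ⊗ₜ z))) =
      (sliceR f ∘ₗ G.T₁.toLinearMap ∘ₗ (TensorProduct.mk ℂ A A).flip z).lTensor A
        (G.T₂ (x ⊗ₜ a)) := by
  rw [← lTensor_sliceR_T₂Leg, T₂Leg_T₁, ← LinearMap.comp_apply, ← LinearMap.lTensor_comp,
    lTensor_T₂Leg]
  rfl

/-- The operators `(ι ⊗ f(z ·))Δ` commute with the left leg of `Δ`. -/
lemma T₂_sliceR_T₄ (f : A →ₗ[ℂ] ℂ) (x a z : A) :
    G.T₂ (x ⊗ₜ sliceR f (G.T₄ (z ⊗ₜ a))) =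
      (sliceR f ∘ₗ G.T₄.toLinearMap ∘ₗ TensorProduct.mk ℂ A A z).lTensor A
        (G.T₂ (x ⊗ₜ a)) := by
  let α := (TensorProduct.assoc ℂ A A A).symm
  have h4 : ∀ w b, (mulL z).lTensor A (G.T₁ (b ⊗ₜ w)) =
      (mulR w).lTensor A (G.T₄ (z ⊗ₜ b)) := fun w b => (G.lTensor_T₄ b w z).symm
  -- The coassociativity axiom involves `T₁`, not `T₄`. Multiplying the last leg on the right by w
  -- turns (1 ⊗ z)Δ(b) into (1 ⊗ z)Δ(b)(1 ⊗ w), where `T₁` is available.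
  have key : α (G.T₂Leg x (G.T₄ (z ⊗ₜ a))) = α ((G.T₄.toLinearMap ∘ₗ
      TensorProduct.mk ℂ A A z).lTensor A (G.T₂ (x ⊗ₜ a))) := by
    rw [← sub_eq_zero]
    refine tensor_eq_zero_of_lTensor' mulR G.eq_zero_of_mul_right _ fun w => ?_
    have e1 : ∀ t : A ⊗[ℂ] A, ∀ g : A →ₗ[ℂ] A, g.lTensor (A ⊗[ℂ] A) (α (G.T₂Leg x t)) =
        α (G.T₂Leg x (g.lTensor A t)) := by
      intro t g
      induction t with
      | zero => simp
      | add s t hs ht => simp only [map_add, hs, ht]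
      | tmul r s => simp [T₂Leg_tmul, α]
    have e2 : ∀ t : A ⊗[ℂ] (A ⊗[ℂ] A), ∀ g : A →ₗ[ℂ] A, g.lTensor (A ⊗[ℂ] A) (α t) =
        α ((g.lTensor A).lTensor A t) := by
      intro t g
      induction t with
      | zero => simp
      | add s t hs ht => simp only [map_add, hs, ht]
      | tmul r s =>
        induction s with
        | zero => simp
        | add s t hs ht => simp only [map_add, TensorProduct.tmul_add, hs, ht]
        | tmul p q => simp [α]
    rw [map_sub, e1, e2, ← h4 w a, ← e1, T₂Leg_T₁, e2, sub_eq_zero, T₂Leg_tmul, lTensor_assoc,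
      ← LinearMap.comp_apply, ← LinearMap.lTensor_comp, ← LinearMap.comp_apply,
      ← LinearMap.lTensor_comp]
    congr 3
    exact LinearMap.ext fun b => h4 w b
  rw [← lTensor_sliceR_T₂Leg, α.injective key, ← LinearMap.comp_apply, ← LinearMap.lTensor_comp]

/-! ### The counit -/

lemma exists_ne_zero (G : AlgebraicQuantumGroup A) : ∃ a : A, a ≠ 0 := by
  by_contra! h
  exact G.φ_ne_zero (LinearMap.ext fun a => by simp [h a])

lemma rTensor_mul'_assoc_symm (r : A) (t : A ⊗[ℂ] A) :
    (LinearMap.mul' ℂ A).rTensor A ((TensorProduct.assoc ℂ A A A).symm (r ⊗ₜ t)) =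
      (mulL r).rTensor A t := by
  induction t with
  | zero => simp
  | add s t hs ht => simp only [map_add, TensorProduct.tmul_add, hs, ht]
  | tmul p q => simp

/-- Apply multiplication of the last two legs to coassociativity for the inverse of `T₁`: on the
other side it reassembles (a ⊗ 1)T₁(T₁⁻¹(b ⊗ c)), which is ab ⊗ c. -/
lemma lTensor_mul'_T₁_symm (c : A) (t : A ⊗[ℂ] A) :
    (LinearMap.mul' ℂ A ∘ₗ G.T₁.symm.toLinearMap ∘ₗ
      (TensorProduct.mk ℂ A A).flip c).lTensor A (G.T₂ t) = LinearMap.mul' ℂ A t ⊗ₜ c := by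
  induction t with
  | zero => simp
  | add s t hs ht => simp only [map_add, TensorProduct.add_tmul, hs, ht]
  | tmul a b =>
    have h1 : ∀ u, (LinearMap.mul' ℂ A).lTensor A (G.T₂Leg a u) =
        (mulL a).rTensor A (G.T₁ u) := by
      intro u
      induction u with
      | zero => simp
      | add s t hs ht => simp only [map_add, hs, ht]
      | tmul r s =>
        rw [← lTensor_T₂, lTensor_T₂Leg]
        congr 2
    have h2 := h1 (G.T₁.symm (b ⊗ₜ c))
    rw [T₂Leg_T₁_symm, ← LinearMap.comp_apply, ← LinearMap.lTensor_comp, lTensor_T₂Leg] at h2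
    simpa [LinearMap.comp_assoc] using h2

lemma rTensor_mul'_T₂_symm (b : A) (w : A ⊗[ℂ] A) :
    (LinearMap.mul' ℂ A ∘ₗ G.T₂.symm.toLinearMap).rTensor A
      ((TensorProduct.assoc ℂ A A A).symm (G.T₁.toLinearMap.lTensor A
        (TensorProduct.assoc ℂ A A A (G.T₂ w ⊗ₜ b)))) = (mulR b).lTensor A (G.T₂ w) := by
  induction w with
  | zero => simp
  | add s t hs ht => simp only [map_add, TensorProduct.add_tmul, hs, ht]
  | tmul r s =>
    rw [← G.coassoc, LinearEquiv.symm_apply_apply, ← LinearMap.comp_apply,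
      ← LinearMap.rTensor_comp, lTensor_T₂, ← rTensor_mul'_assoc_symm]
    congr 2
    ext; simp

/-- The counit must satisfy m(T₁⁻¹(q ⊗ d)) = ε(q)d. By `lTensor_mul'_T₁_symm`, c ⊗ m(T₁⁻¹(q ⊗ d)) =
m(T₂⁻¹(c ⊗ q)) ⊗ d, so this element is indeed a multiple of d, and slicing off c with g(c) = 1 reads
off the scalar. -/
lemma exists_isCounit : ∃ ε, G.IsCounit ε := by
  obtain ⟨c, hc⟩ := G.exists_ne_zero
  obtain ⟨g, hg⟩ := Module.Projective.exists_dual_eq_one ℂ hc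
  let ε : A →ₗ[ℂ] ℂ := g ∘ₗ LinearMap.mul' ℂ A ∘ₗ G.T₂.symm.toLinearMap ∘ₗ
    TensorProduct.mk ℂ A A c
  have h1 : ∀ q d, LinearMap.mul' ℂ A (G.T₁.symm (q ⊗ₜ d)) = ε q • d := by
    intro q d
    have h := congrArg (sliceL g) (G.lTensor_mul'_T₁_symm d (G.T₂.symm (c ⊗ₜ q)))
    simpa [hg, ε] using h
  have h2 : ∀ t, sliceR ε (G.T₂ t) = LinearMap.mul' ℂ A t := by
    intro t
    have h := congrArg (sliceR g) (G.lTensor_mul'_T₁_symm c t)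
    have : LinearMap.mul' ℂ A ∘ₗ G.T₁.symm.toLinearMap ∘ₗ
      (TensorProduct.mk ℂ A A).flip c = ε.smulRight c := LinearMap.ext fun q => by simp [h1]
    rw [this, lTensor_smulRight] at h
    simpa [hg] using h
  have h3 : ∀ p q, LinearMap.mul' ℂ A (G.T₂.symm (p ⊗ₜ q)) = ε q • p := by
    intro p q
    rw [← h2]; simp
  refine ⟨ε, fun a b => ?_, fun a b => by simp [h2]⟩
  have h := G.rTensor_mul'_T₂_symm b (G.T₂.symm (c ⊗ₜ a))
  rw [LinearEquiv.apply_symm_apply] at h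
  have h4 : ∀ t : A ⊗[ℂ] A, (LinearMap.mul' ℂ A ∘ₗ G.T₂.symm.toLinearMap).rTensor A
      ((TensorProduct.assoc ℂ A A A).symm (c ⊗ₜ t)) = c ⊗ₜ sliceL ε t := by
    intro t
    induction t with
    | zero => simp
    | add s t hs ht => simp only [map_add, TensorProduct.tmul_add, hs, ht]
    | tmul p q => simp [h3, TensorProduct.smul_tmul]
  have h5 := congrArg (sliceL g) h
  simp only [TensorProduct.assoc_tmul, LinearMap.lTensor_tmul, LinearEquiv.coe_coe, h4,
    sliceL_tmul, hg] at h5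
  simpa using h5

lemma isCounit_ε : G.IsCounit G.ε := Classical.epsilon_spec G.exists_isCounit

lemma sliceL_ε_T₁ (a b : A) : sliceL G.ε (G.T₁ (a ⊗ₜ b)) = a * b := G.isCounit_ε.1 a b

lemma sliceR_ε_T₂ (a b : A) : sliceR G.ε (G.T₂ (a ⊗ₜ b)) = a * b := G.isCounit_ε.2 a b

lemma mul'_T₁_symm (t : A ⊗[ℂ] A) : LinearMap.mul' ℂ A (G.T₁.symm t) = sliceL G.ε t := by
  obtain ⟨t, rfl⟩ := G.T₁.surjective t
  rw [LinearEquiv.symm_apply_apply]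
  induction t with
  | zero => simp
  | add s t hs ht => simp only [map_add, hs, ht]
  | tmul r s => simp [sliceL_ε_T₁]

/-- Since Δ is multiplicative, (ε ⊗ ι)(Δ(a)t) = a(ε ⊗ ι)(t). Taking t = b ⊗ s evaluates the
functional ε(· b) on the left leg of Δ(r)(1 ⊗ s), and such elements span A ⊗ A. -/
lemma ε_mul (a b : A) : G.ε (a * b) = G.ε a * G.ε b := by
  obtain ⟨c, hc⟩ := G.exists_ne_zero
  have h1 : ∀ a t, sliceL G.ε ((G.Δ a).lmul t) = a * sliceL G.ε t := by
    intro a t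
    obtain ⟨t, rfl⟩ := G.T₁.surjective t
    induction t with
    | zero => simp
    | add s t hs ht => simp only [map_add, mul_add, hs, ht]
    | tmul r s => rw [lmul_T₁, sliceL_ε_T₁, sliceL_ε_T₁, mul_assoc]
  have h2 : ∀ s, sliceL (G.ε ∘ₗ mulR b) s = G.ε b • sliceL G.ε s := by
    intro t
    obtain ⟨t, rfl⟩ := G.T₁.surjective t
    induction t with
    | zero => simp
    | add s t hs ht => simp only [map_add, smul_add, hs, ht]
    | tmul r s =>
      rw [← sliceL_rTensor, ← lmul_tmul, h1, sliceL_ε_T₁]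
      simp [mul_smul_comm]
  have h3 := h2 (a ⊗ₜ c)
  simp only [sliceL_tmul, smul_smul] at h3
  have := smul_left_injective ℂ hc h3
  simpa [mul_comm] using this

lemma ε_ne_zero : G.ε ≠ 0 := by
  intro h
  obtain ⟨c, hc⟩ := G.exists_ne_zero
  refine hc (G.eq_zero_of_mul_left _ fun e => ?_)
  rw [← sliceR_ε_T₂, h]
  simp [sliceR]

lemma sliceR_ε_comp_mulR (b : A) (t : A ⊗[ℂ] A) :
    sliceR (G.ε ∘ₗ mulR b) t = G.ε b • sliceR G.ε t := by
  have : G.ε ∘ₗ mulR b = G.ε b • G.ε := LinearMap.ext fun x => by simp [ε_mul, mul_comm]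
  rw [this]; simp [sliceR, LinearMap.lTensor_smul]

lemma sliceR_ε_T₁ (a b : A) : sliceR G.ε (G.T₁ (a ⊗ₜ b)) = G.ε b • a := by
  refine G.ext_mul_left fun e => ?_
  have h := congrArg (sliceR G.ε) (G.lTensor_T₂ a b e)
  rw [sliceR_lTensor, sliceR_rTensor, sliceR_ε_comp_mulR, sliceR_ε_T₂] at h
  simpa [mul_smul_comm] using h.symm

lemma sliceR_ε_T₃ (a b : A) : sliceR G.ε (G.T₃ (a ⊗ₜ b)) = a * b := by
  refine G.ext_mul_left fun e => ?_
  have h := congrArg (sliceR G.ε) (G.rTensor_T₂ a b e)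
  rw [sliceR_rTensor, sliceR_rTensor, sliceR_ε_T₂] at h
  simpa [mul_assoc] using h.symm

lemma sliceL_ε_T₄ (a b : A) : sliceL G.ε (G.T₄ (a ⊗ₜ b)) = a * b := by
  refine ext_mul G fun e => ?_
  have h := congrArg (sliceL G.ε) (G.lTensor_T₄ b e a)
  rw [sliceL_lTensor, sliceL_lTensor, sliceL_ε_T₁] at h
  simpa [mul_assoc] using h

end AlgebraicQuantumGroup

namespace AlgebraicQuantumGroup

variable {A : Type*} [NonUnitalRing A] [Module ℂ A] [SMulCommClass ℂ A A] [IsScalarTower ℂ A A]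
  (G : AlgebraicQuantumGroup A)

/-! ### Invariant functionals -/

/-- `(ι ⊗ f)Δ(a) = f(a)1`. -/
def IsLeftInvariant (f : A →ₗ[ℂ] ℂ) : Prop := ∀ a b, sliceR f (G.T₂ (b ⊗ₜ a)) = f a • b

/-- `(f ⊗ ι)Δ(a) = f(a)1`. -/
def IsRightInvariant (f : A →ₗ[ℂ] ℂ) : Prop := ∀ a b, sliceL f (G.T₁ (a ⊗ₜ b)) = f a • b

lemma isLeftInvariant_φ : G.IsLeftInvariant G.φ := G.left_invariant'

variable {G}

lemma IsLeftInvariant.sliceR_T₃ {f : A →ₗ[ℂ] ℂ} (hf : G.IsLeftInvariant f) (a b : A) :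
    sliceR f (G.T₃ (a ⊗ₜ b)) = f a • b := by
  refine G.ext_mul_left fun e => ?_
  have h := congrArg (sliceR f) (G.rTensor_T₂ a b e)
  rw [sliceR_rTensor, sliceR_rTensor, hf] at h
  simpa [mul_smul_comm, smul_mul_assoc] using h.symm

variable (G) in
/-- `a ↦ Δ(a) t`. -/
def ΔMul (t : A ⊗[ℂ] A) : A →ₗ[ℂ] A ⊗[ℂ] A where
  toFun a := (G.Δ a).lmul t
  map_add' a b := by rw [map_add]; rfl
  map_smul' r a := by rw [map_smul]; rfl

variable (G) in
/-- `a ↦ t Δ(a)`. -/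
def mulΔ (t : A ⊗[ℂ] A) : A →ₗ[ℂ] A ⊗[ℂ] A where
  toFun a := (G.Δ a).rmul t
  map_add' a b := by rw [map_add]; rfl
  map_smul' r a := by rw [map_smul]; rfl

lemma ΔMul_apply (t : A ⊗[ℂ] A) (a : A) : G.ΔMul t a = (G.Δ a).lmul t := rfl

lemma mulΔ_apply (t : A ⊗[ℂ] A) (a : A) : G.mulΔ t a = (G.Δ a).rmul t := rfl

lemma ΔMul_add (s t : A ⊗[ℂ] A) : G.ΔMul (s + t) = G.ΔMul s + G.ΔMul t :=
  LinearMap.ext fun a => map_add (G.Δ a).lmul s t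

lemma ΔMul_zero : G.ΔMul (0 : A ⊗[ℂ] A) = 0 := LinearMap.ext fun a => map_zero (G.Δ a).lmul

lemma mulΔ_add (s t : A ⊗[ℂ] A) : G.mulΔ (s + t) = G.mulΔ s + G.mulΔ t :=
  LinearMap.ext fun a => map_add (G.Δ a).rmul s t

lemma mulΔ_zero : G.mulΔ (0 : A ⊗[ℂ] A) = 0 := LinearMap.ext fun a => map_zero (G.Δ a).rmul

/-- `κ(a₁ f(a₂ b)) q = b₁ q f(a b₂)`, where `κ` is the map that will be the antipode. -/
lemma IsLeftInvariant.sliceL_T₁_symm {f : A →ₗ[ℂ] ℂ} (hf : G.IsLeftInvariant f) (a b q : A) :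
    sliceL G.ε (G.T₁.symm (sliceR f (G.T₁ (a ⊗ₜ b)) ⊗ₜ q)) = sliceR f (G.T₄ (a ⊗ₜ b)) * q := by
  let D : A →ₗ[ℂ] A := sliceR f ∘ₗ G.T₁.toLinearMap ∘ₗ TensorProduct.mk ℂ A A a
  have h1 : ∀ x t, (mulL x).rTensor A (G.T₁ (TensorProduct.comm ℂ A A (D.lTensor A t))) =
      (sliceR f ∘ₗ G.ΔMul t).lTensor A (G.T₂ (x ⊗ₜ a)) := by
    intro x t
    induction t with
    | zero => simp [ΔMul_zero]
    | add s t hs ht => simp only [map_add, hs, ht, ΔMul_add, LinearMap.comp_add,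
        LinearMap.lTensor_add, LinearMap.add_apply]
    | tmul y z =>
      simp only [LinearMap.lTensor_tmul, TensorProduct.comm_tmul]
      rw [← lTensor_T₂]
      simp only [D, LinearMap.comp_apply, LinearEquiv.coe_coe, TensorProduct.mk_apply]
      rw [T₂_sliceR_T₁, ← LinearMap.comp_apply, ← LinearMap.lTensor_comp]
      congr 2
      refine LinearMap.ext fun b => ?_
      simp [ΔMul_apply, lmul_tmul, sliceR_rTensor]
  have h2 : ∀ t, sliceL G.ε (TensorProduct.comm ℂ A A (D.lTensor A t)) =
      sliceR f ((mulL a).lTensor A t) := by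
    intro t
    rw [sliceL_comm, sliceR_lTensor, sliceR_lTensor]
    congr 2
    refine LinearMap.ext fun z => ?_
    simp [D, ← apply_sliceL G.ε f, sliceL_ε_T₁]
  -- In Sweedler notation the left side is a₁ ⊗ a₂b₁q f(a₃b₂), and invariance of f at a₂b collapses
  -- it. The preimage under `T₁` is therefore explicit, and applying ε ⊗ ι to it gives the claim.
  have h3 : G.T₁ (TensorProduct.comm ℂ A A (D.lTensor A (G.T₃ (b ⊗ₜ q)))) =
      sliceR f (G.T₁ (a ⊗ₜ b)) ⊗ₜ q := by
    refine G.eq_of_rTensor_mulL fun x => ?_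
    have h4 : sliceR f ∘ₗ G.ΔMul (G.T₃ (b ⊗ₜ q)) = (f ∘ₗ mulR b).smulRight q := by
      refine LinearMap.ext fun a' => ?_
      simp [ΔMul_apply, lmul_T₃, hf.sliceR_T₃]
    rw [h1, h4, lTensor_smulRight, ← sliceR_lTensor, lTensor_T₂, sliceR_rTensor]
    simp
  rw [← h3, LinearEquiv.symm_apply_apply, h2, ← rTensor_T₄, sliceR_rTensor]
  simp

/-- `q κ⁻¹(b₁ f(a b₂)) = q a₁ f(a₂ b)`, where `κ` is the map that will be the antipode. -/
lemma IsLeftInvariant.sliceR_T₄_symm {f : A →ₗ[ℂ] ℂ} (hf : G.IsLeftInvariant f) (a b q : A) :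
    sliceR G.ε (G.T₄.symm (sliceR f (G.T₄ (a ⊗ₜ b)) ⊗ₜ q)) = q * sliceR f (G.T₁ (a ⊗ₜ b)) := by
  let D : A →ₗ[ℂ] A := sliceR f ∘ₗ G.T₄.toLinearMap ∘ₗ (TensorProduct.mk ℂ A A).flip b
  have h1 : ∀ x t, (mulL x).rTensor A (G.T₄ (D.lTensor A t)) =
      (sliceR f ∘ₗ G.mulΔ t).lTensor A (G.T₂ (x ⊗ₜ b)) := by
    intro x t
    induction t with
    | zero => simp [mulΔ_zero]
    | add s t hs ht => simp only [map_add, hs, ht, mulΔ_add, LinearMap.comp_add,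
        LinearMap.lTensor_add, LinearMap.add_apply]
    | tmul y z =>
      simp only [LinearMap.lTensor_tmul]
      rw [← lTensor_mulL_T₂]
      simp only [D, LinearMap.comp_apply, LinearEquiv.coe_coe, TensorProduct.mk_apply,
        LinearMap.flip_apply]
      rw [T₂_sliceR_T₄, ← LinearMap.comp_apply, ← LinearMap.lTensor_comp]
      congr 2
      refine LinearMap.ext fun b => ?_
      simp [mulΔ_apply, rmul_tmul, lTensor_mulL_T₂, sliceR_rTensor]
  have h2 : ∀ t, sliceR G.ε (D.lTensor A t) = sliceR f ((mulR b).lTensor A t) := by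
    intro t
    rw [sliceR_lTensor, sliceR_lTensor]
    congr 2
    refine LinearMap.ext fun z => ?_
    simp [D, ← apply_sliceL G.ε f, sliceL_ε_T₄]
  -- Here the left side is b₁ ⊗ qa₁b₂ f(a₂b₃), and invariance of f at ab₂ collapses it.
  have h3 : G.T₄ (D.lTensor A (G.T₂ (q ⊗ₜ a))) = sliceR f (G.T₄ (a ⊗ₜ b)) ⊗ₜ q := by
    refine G.eq_of_rTensor_mulL fun x => ?_
    have h4 : sliceR f ∘ₗ G.mulΔ (G.T₂ (q ⊗ₜ a)) = (f ∘ₗ mulL a).smulRight q := by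
      refine LinearMap.ext fun a' => ?_
      simp [mulΔ_apply, rmul_T₂, hf _ _]
    rw [h1, h4, lTensor_smulRight, ← sliceR_lTensor, lTensor_mulL_T₂, sliceR_rTensor]
    simp
  rw [← h3, LinearEquiv.symm_apply_apply, h2, lTensor_T₂, sliceR_rTensor]
  simp

lemma IsLeftInvariant.sliceL_T₁_symm' {f : A →ₗ[ℂ] ℂ} (hf : G.IsLeftInvariant f)
    (t : A ⊗[ℂ] A) (q : A) :
    sliceL G.ε (G.T₁.symm (sliceR f (G.T₁ t) ⊗ₜ q)) = sliceR f (G.T₄ t) * q := by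
  induction t with
  | zero => simp
  | add s t hs ht => simp only [map_add, TensorProduct.add_tmul, hs, ht, add_mul]
  | tmul a b => exact hf.sliceL_T₁_symm a b q

lemma IsLeftInvariant.sliceR_T₄_symm' {f : A →ₗ[ℂ] ℂ} (hf : G.IsLeftInvariant f)
    (t : A ⊗[ℂ] A) (q : A) :
    sliceR G.ε (G.T₄.symm (sliceR f (G.T₄ t) ⊗ₜ q)) = q * sliceR f (G.T₁ t) := by
  induction t with
  | zero => simp
  | add s t hs ht => simp only [map_add, TensorProduct.add_tmul, hs, ht, mul_add]
  | tmul a b => exact hf.sliceR_T₄_symm a b q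

/-! ### The antipode -/

variable (G)

/-- Slices by φ of `T₁` and of `T₄` both exhaust A, and the two formulas `sliceL_T₁_symm'` and
`sliceR_T₄_symm'` show that one slice vanishes exactly when the other does. Equal kernels give
well-definedness and bijectivity together. -/
lemma exists_antipode :
    ∃ S : A ≃ₗ[ℂ] A, ∀ x q, S x * q = sliceL G.ε (G.T₁.symm (x ⊗ₜ q)) := by
  have hφ := G.isLeftInvariant_φ
  have hP : Function.Surjective (sliceR G.φ ∘ₗ G.T₁.toLinearMap) :=
    (sliceR_surjective G.φ_ne_zero).comp G.T₁.surjective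
  have hQ : Function.Surjective (sliceR G.φ ∘ₗ G.T₄.toLinearMap) :=
    (sliceR_surjective G.φ_ne_zero).comp G.T₄.surjective
  obtain ⟨S, hS⟩ := exists_linearEquiv_of_ker_eq _ _ hP hQ (by
    ext t
    simp only [LinearMap.mem_ker, LinearMap.comp_apply, LinearEquiv.coe_coe]
    constructor
    · intro h
      refine G.eq_zero_of_mul_right _ fun q => ?_
      rw [← hφ.sliceL_T₁_symm', h]; simp
    · intro h
      refine G.eq_zero_of_mul_left _ fun q => ?_
      rw [← hφ.sliceR_T₄_symm', h]; simp)
  refine ⟨S, fun x q => ?_⟩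
  obtain ⟨t, rfl⟩ := hP x
  rw [hS]
  exact (hφ.sliceL_T₁_symm' t q).symm

/-- This is T₁⁻¹(b ⊗ c) = b₁ ⊗ S(b₂)c, obtained by applying the counit to the middle leg of
coassociativity. Multiplying the legs gives the second antipode axiom. -/
lemma rTensor_T₁_symm {S : A →ₗ[ℂ] A} (hS : ∀ x q, S x * q = sliceL G.ε (G.T₁.symm (x ⊗ₜ q)))
    (a b c : A) : (mulL a).rTensor A (G.T₁.symm (b ⊗ₜ c)) =
      (mulR c ∘ₗ S).lTensor A (G.T₂ (a ⊗ₜ b)) := by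
  have h := congrArg ((sliceL G.ε).lTensor A) (G.T₂Leg_T₁_symm a (b ⊗ₜ c))
  rw [lTensor_sliceL_T₂Leg, ← LinearMap.comp_apply (LinearMap.lTensor A _),
    ← LinearMap.lTensor_comp, lTensor_T₂Leg] at h
  have h1 : sliceR G.ε ∘ₗ G.T₂.toLinearMap ∘ₗ TensorProduct.mk ℂ A A a = mulL a :=
    LinearMap.ext fun b => by simp [sliceR_ε_T₂]
  have h2 : (sliceL G.ε ∘ₗ G.T₁.symm.toLinearMap) ∘ₗ (TensorProduct.mk ℂ A A).flip c =
      mulR c ∘ₗ S := LinearMap.ext fun b => by simp [hS]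
  rwa [h1, h2] at h

lemma mul'_rTensor_mulL (a : A) (t : A ⊗[ℂ] A) :
    LinearMap.mul' ℂ A ((mulL a).rTensor A t) = a * LinearMap.mul' ℂ A t := by
  induction t with
  | zero => simp
  | add s t hs ht => simp only [map_add, mul_add, hs, ht]
  | tmul p q => simp [mul_assoc]

lemma mul'_lTensor_mulR (a : A) (t : A ⊗[ℂ] A) :
    LinearMap.mul' ℂ A ((mulR a).lTensor A t) = LinearMap.mul' ℂ A t * a := by
  induction t with
  | zero => simp
  | add s t hs ht => simp only [map_add, add_mul, hs, ht]
  | tmul p q => simp [mul_assoc]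

lemma exists_isAntipode : ∃ S, G.IsAntipode S := by
  obtain ⟨S, hS⟩ := G.exists_antipode
  refine ⟨S, fun a b => ?_, fun a b => ext_mul G fun c => ?_⟩
  · have h1 : ∀ t : A ⊗[ℂ] A, LinearMap.mul' ℂ A (S.toLinearMap.rTensor A t) =
        sliceL G.ε (G.T₁.symm t) := by
      intro t
      induction t with
      | zero => simp
      | add s t hs ht => simp only [map_add, hs, ht]
      | tmul p q => simp [hS]
    rw [h1]; simp
  · have h := congrArg (LinearMap.mul' ℂ A) (G.rTensor_T₁_symm (S := S.toLinearMap) hS a b c)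
    rw [mul'_rTensor_mulL, mul'_T₁_symm, LinearMap.lTensor_comp, LinearMap.comp_apply,
      mul'_lTensor_mulR] at h
    rw [← h]
    simp [mul_smul_comm, smul_mul_assoc]

lemma isAntipode_S : G.IsAntipode G.S := Classical.epsilon_spec G.exists_isAntipode

lemma mul'_rTensor_S (t : A ⊗[ℂ] A) :
    LinearMap.mul' ℂ A (G.S.toLinearMap.rTensor A t) = sliceL G.ε (G.T₁.symm t) := by
  obtain ⟨t, rfl⟩ := G.T₁.surjective t
  rw [LinearEquiv.symm_apply_apply]
  induction t with
  | zero => simp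
  | add s t hs ht => simp only [map_add, hs, ht]
  | tmul p q => simp [G.isAntipode_S.1]

lemma S_mul_eq (x q : A) : G.S x * q = sliceL G.ε (G.T₁.symm (x ⊗ₜ q)) := by
  rw [← mul'_rTensor_S]; simp

variable {G} in
lemma IsLeftInvariant.S_sliceR_T₁ {f : A →ₗ[ℂ] ℂ} (hf : G.IsLeftInvariant f) (t : A ⊗[ℂ] A) :
    G.S (sliceR f (G.T₁ t)) = sliceR f (G.T₄ t) :=
  ext_mul G fun q => by rw [S_mul_eq, hf.sliceL_T₁_symm']

lemma lmul_T₁' (a : A) (t : A ⊗[ℂ] A) :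
    (G.Δ a).lmul (G.T₁ t) = G.T₁ ((mulL a).rTensor A t) := by
  induction t with
  | zero => simp
  | add s t hs ht => simp only [map_add, hs, ht]
  | tmul p q => simp [lmul_T₁]

/-- Because Δ(r)T₁(t) = T₁((r ⊗ 1)t) and ε is multiplicative, right multiplication by y on the first
leg becomes left multiplication by S(y) after applying (ε ⊗ ι)T₁⁻¹, the map that defines S. -/
lemma S_mul (x y : A) : G.S (x * y) = G.S y * G.S x := by
  refine ext_mul G fun q => ?_
  have h : ∀ u, sliceL G.ε (G.T₁.symm ((mulR y).rTensor A (G.T₁ u))) =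
      G.S y * sliceL G.ε u := by
    intro u
    induction u with
    | zero => simp
    | add s t hs ht => simp only [map_add, mul_add, hs, ht]
    | tmul r s =>
      rw [← lmul_tmul, ← G.T₁.apply_symm_apply (y ⊗ₜ s), lmul_T₁', LinearEquiv.symm_apply_apply,
        sliceL_rTensor]
      have h1 : G.ε ∘ₗ mulL r = G.ε r • G.ε := LinearMap.ext fun x => by simp [ε_mul]
      rw [h1, sliceL_tmul, mul_smul_comm, S_mul_eq]
      simp [sliceL, LinearMap.rTensor_smul]
  have h2 := h (G.T₁.symm (x ⊗ₜ q))
  rw [LinearEquiv.apply_symm_apply, ← S_mul_eq] at h2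
  rw [mul_assoc, ← h2, S_mul_eq]
  simp

lemma S_symm_mul (x y : A) : G.S.symm (x * y) = G.S.symm y * G.S.symm x :=
  G.S.injective (by simp [S_mul])

/-- For x = (ι ⊗ φ)(Δ(a)(1 ⊗ b)), the counit of both x and S(x) is φ(ab). -/
lemma ε_S (x : A) : G.ε (G.S x) = G.ε x := by
  have hP : Function.Surjective (sliceR G.φ ∘ₗ G.T₁.toLinearMap) :=
    (sliceR_surjective G.φ_ne_zero).comp G.T₁.surjective
  obtain ⟨t, rfl⟩ := hP x
  simp only [LinearMap.comp_apply, LinearEquiv.coe_coe]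
  rw [G.isLeftInvariant_φ.S_sliceR_T₁, ← apply_sliceL, ← apply_sliceL]
  induction t with
  | zero => simp
  | add s t hs ht => simp only [map_add, hs, ht]
  | tmul p q => rw [sliceL_ε_T₁, sliceL_ε_T₄]

lemma ε_S_symm (x : A) : G.ε (G.S.symm x) = G.ε x := by
  rw [← ε_S, LinearEquiv.apply_symm_apply]

end AlgebraicQuantumGroup

/-! ### Tensors with one leg in a subspace -/

section

variable {A : Type*} [AddCommGroup A] [Module ℂ A]

/-- If all slices `(ι ⊗ fₓ) t` vanish, then `t` lies in `A ⊗ N` for `N = ⋂ ker fₓ`; hence every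
linear map which kills `A ⊗ N` kills `t`. -/
lemma apply_eq_zero_of_sliceR {M X : Type*} [AddCommGroup M] [Module ℂ M]
    (f : X → A →ₗ[ℂ] ℂ) (t : A ⊗[ℂ] A) (h : ∀ x, sliceR (f x) t = 0) (F : A ⊗[ℂ] A →ₗ[ℂ] M)
    (hF : ∀ p q, (∀ x, f x q = 0) → F (p ⊗ₜ q) = 0) : F t = 0 := by
  let N : Submodule ℂ A := ⨅ x, LinearMap.ker (f x)
  have hN : ∀ q, q ∈ N ↔ ∀ x, f x q = 0 := fun q => by simp [N]
  have h1 : N.mkQ.lTensor A t = 0 := by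
    apply (TensorProduct.comm ℂ A (A ⧸ N)).injective
    rw [map_zero]
    refine tensor_eq_zero_of_slice _ fun g => ?_
    have h2 : TensorProduct.rid ℂ (A ⧸ N) (g.lTensor (A ⧸ N)
        (TensorProduct.comm ℂ A (A ⧸ N) (N.mkQ.lTensor A t))) = N.mkQ (sliceL g t) := by
      clear h
      induction t with
      | zero => simp
      | add s t hs ht => simp only [map_add, hs, ht]
      | tmul p q => simp
    rw [h2, Submodule.mkQ_apply, Submodule.Quotient.mk_eq_zero, hN]
    intro x
    rw [apply_sliceL, h, map_zero]
  obtain ⟨u, rfl⟩ := (lTensor_exact A (LinearMap.exact_subtype_mkQ N) N.mkQ_surjective t).1 h1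
  clear h h1
  induction u with
  | zero => simp
  | add s t hs ht => simp only [map_add, hs, ht, add_zero]
  | tmul p q => exact hF p q ((hN q).1 q.2)

lemma comm_rTensor (g : A →ₗ[ℂ] A) (t : A ⊗[ℂ] A) :
    TensorProduct.comm ℂ A A (g.rTensor A t) = g.lTensor A (TensorProduct.comm ℂ A A t) := by
  induction t with
  | zero => simp
  | add s t hs ht => simp only [map_add, hs, ht]
  | tmul p q => simp

lemma comm_lTensor (g : A →ₗ[ℂ] A) (t : A ⊗[ℂ] A) :
    TensorProduct.comm ℂ A A (g.lTensor A t) = g.rTensor A (TensorProduct.comm ℂ A A t) := by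
  induction t with
  | zero => simp
  | add s t hs ht => simp only [map_add, hs, ht]
  | tmul p q => simp

end

namespace AlgebraicQuantumGroup

variable {A : Type*} [NonUnitalRing A] [Module ℂ A] [SMulCommClass ℂ A A] [IsScalarTower ℂ A A]
  (G : AlgebraicQuantumGroup A)

/-! ### The antipode reverses the coproduct -/

/-- `S ⊗ S`. -/
noncomputable def SS : A ⊗[ℂ] A →ₗ[ℂ] A ⊗[ℂ] A :=
  TensorProduct.map G.S.toLinearMap G.S.toLinearMap

lemma SS_tmul (a b : A) : G.SS (a ⊗ₜ b) = G.S a ⊗ₜ G.S b := rfl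

lemma SS_rTensor_mulL (c : A) (t : A ⊗[ℂ] A) :
    G.SS ((mulL c).rTensor A t) = (mulR (G.S c)).rTensor A (G.SS t) := by
  induction t with
  | zero => simp
  | add s t hs ht => simp only [map_add, hs, ht]
  | tmul p q => simp [SS_tmul, S_mul]

lemma SS_rTensor_mulR (c : A) (t : A ⊗[ℂ] A) :
    G.SS ((mulR c).rTensor A t) = (mulL (G.S c)).rTensor A (G.SS t) := by
  induction t with
  | zero => simp
  | add s t hs ht => simp only [map_add, hs, ht]
  | tmul p q => simp [SS_tmul, S_mul]

lemma SS_lTensor_mulR (c : A) (t : A ⊗[ℂ] A) :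
    G.SS ((mulR c).lTensor A t) = (mulL (G.S c)).lTensor A (G.SS t) := by
  induction t with
  | zero => simp
  | add s t hs ht => simp only [map_add, hs, ht]
  | tmul p q => simp [SS_tmul, S_mul]

lemma sliceR_φ_T₁_surjective :
    Function.Surjective (sliceR G.φ ∘ₗ G.T₁.toLinearMap) :=
  (sliceR_surjective G.φ_ne_zero).comp G.T₁.surjective

/-- Write a as a slice of Δ(c)(1 ⊗ d), so that S(a) is the slice of (1 ⊗ c)Δ(d). The coproducts of
both are controlled by `T₂_sliceR_T₁` and `T₂_sliceR_T₄`; the auxiliary identity `key` compares the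
results through S on slices. -/
lemma SS_T₁ (a b : A) :
    G.SS (G.T₁ (a ⊗ₜ b)) = TensorProduct.comm ℂ A A (G.T₂ (G.S b ⊗ₜ G.S a)) := by
  obtain ⟨t, rfl⟩ := G.sliceR_φ_T₁_surjective a
  induction t with
  | zero => simp
  | add s t hs ht => simp only [map_add, TensorProduct.add_tmul, TensorProduct.tmul_add, hs, ht]
  | tmul c d =>
    simp only [LinearMap.comp_apply, LinearEquiv.coe_coe]
    obtain ⟨Q, hQ⟩ : ∃ Q : A →ₗ[ℂ] A, ∀ z, Q z = sliceR G.φ (G.T₄ (c ⊗ₜ z)) :=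
      ⟨sliceR G.φ ∘ₗ G.T₄.toLinearMap ∘ₗ TensorProduct.mk ℂ A A c, fun z => rfl⟩
    let E : A ⊗[ℂ] A → A →ₗ[ℂ] A := fun w =>
      sliceR G.φ ∘ₗ LinearMap.applyₗ w ∘ₗ LinearMap.lTensorHom A ∘ₗ LinearMap.mul ℂ A
    have hE : ∀ w x, E w x = sliceR G.φ ((mulL x).lTensor A w) := fun w x => rfl
    have key : ∀ x w, TensorProduct.map G.S.toLinearMap (E w) (G.T₂ (x ⊗ₜ c)) =
        (mulR (G.S x)).rTensor A (TensorProduct.comm ℂ A A (Q.lTensor A w)) := by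
      intro x w
      induction w with
      | zero => simp [E]
      | add s t hs ht =>
        have : E (s + t) = E s + E t := LinearMap.ext fun x => by simp [hE]
        rw [this, TensorProduct.map_add_right, LinearMap.add_apply, hs, ht]
        simp only [map_add]
      | tmul y z =>
        have h1 : E (y ⊗ₜ z) = (G.φ ∘ₗ mulR z).smulRight y :=
          LinearMap.ext fun x => by simp [hE]
        rw [h1, ← LinearMap.rTensor_comp_lTensor, LinearMap.comp_apply, lTensor_smulRight,
          ← sliceR_lTensor, lTensor_T₂, sliceR_rTensor]
        simp [S_mul, hQ, G.isLeftInvariant_φ.S_sliceR_T₁]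
    refine G.eq_of_rTensor_mulR fun x' => ?_
    obtain ⟨x, rfl⟩ := G.S.surjective x'
    rw [← SS_rTensor_mulL, ← lTensor_T₂, T₂_sliceR_T₁, G.isLeftInvariant_φ.S_sliceR_T₁,
      T₂_sliceR_T₄]
    have h2 : sliceR G.φ ∘ₗ G.T₄.toLinearMap ∘ₗ TensorProduct.mk ℂ A A c = Q :=
      LinearMap.ext fun z => (hQ z).symm
    rw [h2, ← key, SS, ← LinearMap.comp_apply (LinearMap.lTensor A _), ← LinearMap.lTensor_comp,
      ← LinearMap.comp_apply, LinearMap.map_comp_lTensor]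
    congr 2
    refine LinearMap.ext fun e => ?_
    rw [hE, lTensor_mulL_T₂, sliceR_rTensor]
    simp [S_mul, G.isLeftInvariant_φ.S_sliceR_T₁]

lemma SS_T₂ (a b : A) :
    G.SS (G.T₂ (b ⊗ₜ a)) = TensorProduct.comm ℂ A A (G.T₁ (G.S a ⊗ₜ G.S b)) := by
  refine G.eq_of_lTensor_mulL fun x' => ?_
  obtain ⟨x, rfl⟩ := G.S.surjective x'
  rw [← SS_lTensor_mulR, lTensor_T₂, SS_rTensor_mulL, SS_T₁, ← comm_lTensor, lTensor_T₂,
    comm_rTensor]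

lemma SS_T₃ (a b : A) :
    G.SS (G.T₃ (a ⊗ₜ b)) = TensorProduct.comm ℂ A A (G.T₄ (G.S b ⊗ₜ G.S a)) := by
  refine G.eq_of_lTensor_mulL fun x' => ?_
  obtain ⟨x, rfl⟩ := G.S.surjective x'
  rw [← SS_lTensor_mulR, ← rTensor_T₁_eq_lTensor_T₃, SS_rTensor_mulR, SS_T₁, ← comm_lTensor,
    lTensor_mulL_T₂, comm_rTensor]

variable {G}

lemma IsLeftInvariant.comp_S {f : A →ₗ[ℂ] ℂ} (hf : G.IsLeftInvariant f) :
    G.IsRightInvariant (f ∘ₗ G.S.toLinearMap) := by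
  intro a b
  apply G.S.injective
  have h := sliceL_map f G.S.toLinearMap G.S.toLinearMap (G.T₁ (a ⊗ₜ b))
  change sliceL f (G.SS _) = _ at h
  rw [SS_T₁, sliceL_comm, hf] at h
  simpa using h.symm

lemma IsLeftInvariant.comp_S_symm {f : A →ₗ[ℂ] ℂ} (hf : G.IsLeftInvariant f) :
    G.IsRightInvariant (f ∘ₗ G.S.symm.toLinearMap) := by
  intro a b
  obtain ⟨a, rfl⟩ := G.S.surjective a
  obtain ⟨b, rfl⟩ := G.S.surjective b
  have h := sliceR_map (f ∘ₗ G.S.symm.toLinearMap) G.S.toLinearMap G.S.toLinearMap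
    (G.T₂ (b ⊗ₜ a))
  change sliceR _ (G.SS _) = _ at h
  rw [SS_T₂, sliceR_comm, LinearMap.comp_assoc] at h
  simpa [hf a b] using h

lemma IsRightInvariant.comp_S {f : A →ₗ[ℂ] ℂ} (hf : G.IsRightInvariant f) :
    G.IsLeftInvariant (f ∘ₗ G.S.toLinearMap) := by
  intro a b
  apply G.S.injective
  have h := sliceR_map f G.S.toLinearMap G.S.toLinearMap (G.T₂ (b ⊗ₜ a))
  change sliceR f (G.SS _) = _ at h
  rw [SS_T₂, sliceR_comm, hf] at h
  simpa using h.symm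

variable (G)

lemma isRightInvariant_ψ : G.IsRightInvariant G.ψ := G.isLeftInvariant_φ.comp_S

/-! ### Faithfulness of the left integral -/

/-- The first antipode axiom with the covering factor b moved to the left leg, where S turns it into
a left factor S(b). It serves both faithfulness of φ and the Plancherel formula. -/
lemma mul'_rTensor_S_T₃ (a b : A) :
    LinearMap.mul' ℂ A (G.S.toLinearMap.rTensor A (G.T₃ (a ⊗ₜ b))) = G.ε a • G.S b := by
  refine ext_mul G fun e => ?_
  have h1 : ∀ t : A ⊗[ℂ] A, (mulR e).lTensor A (G.S.toLinearMap.rTensor A t) =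
      G.S.toLinearMap.rTensor A ((mulR e).lTensor A t) := by
    intro t
    induction t with
    | zero => simp
    | add s t hs ht => simp only [map_add, hs, ht]
    | tmul p q => simp
  have h2 : ∀ t : A ⊗[ℂ] A, G.S.toLinearMap.rTensor A ((mulR b).rTensor A t) =
      (mulL (G.S b)).rTensor A (G.S.toLinearMap.rTensor A t) := by
    intro t
    induction t with
    | zero => simp
    | add s t hs ht => simp only [map_add, hs, ht]
    | tmul p q => simp [S_mul]
  rw [← mul'_lTensor_mulR, h1, ← rTensor_T₁_eq_lTensor_T₃, h2, mul'_rTensor_mulL,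
    G.isAntipode_S.1]
  simp [mul_smul_comm, smul_mul_assoc]

/-- Products span A, since (ε ⊗ ι)T₁ is onto and takes p ⊗ q to pq. -/
lemma exists_φ_mul_ne_zero : ∃ a b, G.φ (a * b) ≠ 0 := by
  by_contra! h
  refine G.φ_ne_zero (LinearMap.ext fun x => ?_)
  obtain ⟨t, rfl⟩ := (sliceL_surjective G.ε_ne_zero).comp G.T₁.surjective x
  induction t with
  | zero => simp
  | add s t hs ht =>
    simp only [Function.comp_apply, map_add, LinearMap.zero_apply] at hs ht ⊢
    rw [hs, ht, add_zero]
  | tmul p q => simp [sliceL_ε_T₁, h]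

/-- Let N be the space of y with φ(by) = 0 for all b. The slice formula for S shows that for y in N
the right leg of Δ(y) stays in N. The antipode axiom then forces ε to vanish on N, and the counit
axiom recovers ea = 0 from Δ(a). -/
lemma eq_zero_of_φ_mul_left {a : A} (ha : ∀ b, G.φ (b * a) = 0) : a = 0 := by
  have hN : ∀ y, (∀ b, G.φ (b * y) = 0) → ∀ b, sliceR G.φ (G.T₄ (b ⊗ₜ y)) = 0 := by
    intro y hy b
    rw [← G.isLeftInvariant_φ.S_sliceR_T₁, map_eq_zero_iff _ G.S.injective]
    refine G.eq_zero_of_mul_left _ fun e => ?_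
    have h := congrArg (sliceR G.φ) (G.lTensor_T₂ b y e)
    have h0 : G.φ ∘ₗ mulR y = 0 := LinearMap.ext fun x => hy x
    rw [sliceR_rTensor, sliceR_lTensor, h0] at h
    simpa [sliceR] using h.symm
  have hε : ∀ y, (∀ b, G.φ (b * y) = 0) → G.ε y = 0 := by
    intro y hy
    obtain ⟨c, d, hcd⟩ := G.exists_φ_mul_ne_zero
    -- The functional p ⊗ q ↦ φ(cS(p)q) kills A ⊗ N, while its value on this tensor is ε(y)φ(cd).
    have h := apply_eq_zero_of_sliceR (fun b => G.φ ∘ₗ mulL b) (G.T₃ (y ⊗ₜ G.S.symm d))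
      (fun b => by rw [← sliceR_lTensor, ← rTensor_T₄, sliceR_rTensor, hN y hy, map_zero])
      (G.φ ∘ₗ mulL c ∘ₗ LinearMap.mul' ℂ A ∘ₗ G.S.toLinearMap.rTensor A)
      (fun p q hq => by
        have := hq (c * G.S p)
        simpa [mul_assoc] using this)
    simp only [LinearMap.comp_apply, mul'_rTensor_S_T₃] at h
    simpa [hcd] using h
  refine G.eq_zero_of_mul_left _ fun e => ?_
  rw [← sliceR_ε_T₂]
  refine apply_eq_zero_of_sliceR (fun b => G.φ ∘ₗ mulL b) (G.T₂ (e ⊗ₜ a))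
    (fun b => by rw [← sliceR_lTensor, lTensor_mulL_T₂, sliceR_rTensor, hN a ha, map_zero])
    (sliceR G.ε) fun p q hq => by simp [hε q hq]

lemma eq_zero_of_φ_mul_right {a : A} (ha : ∀ b, G.φ (a * b) = 0) : a = 0 := by
  have hN : ∀ y, (∀ b, G.φ (y * b) = 0) → ∀ b, sliceR G.φ (G.T₁ (y ⊗ₜ b)) = 0 := by
    intro y hy b
    rw [← map_eq_zero_iff _ G.S.injective, G.isLeftInvariant_φ.S_sliceR_T₁]
    refine G.eq_zero_of_mul_left _ fun e => ?_
    have h := congrArg (sliceR G.φ) (G.lTensor_mulL_T₂ b e y)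
    have h0 : G.φ ∘ₗ mulL y = 0 := LinearMap.ext fun x => hy x
    rw [sliceR_rTensor, sliceR_lTensor, h0] at h
    simpa [sliceR] using h.symm
  have hT : ∀ y, (∀ b, G.φ (y * b) = 0) → ∀ b e,
      sliceR (G.φ ∘ₗ mulR b) (G.T₂ (e ⊗ₜ y)) = 0 := by
    intro y hy b e
    rw [← sliceR_lTensor, lTensor_T₂, sliceR_rTensor, hN y hy, map_zero]
  have hε : ∀ y, (∀ b, G.φ (y * b) = 0) → G.ε y = 0 := by
    intro y hy
    obtain ⟨c, d, hcd⟩ := G.exists_φ_mul_ne_zero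
    -- Now q must stay to the left under φ, so the test functional is φ(S⁻¹(pS(q))d) = φ(qS⁻¹(p)d),
    -- whose value on this tensor is ε(y)φ(cd).
    have h := apply_eq_zero_of_sliceR (fun b => G.φ ∘ₗ mulR b) (G.T₂ (G.S c ⊗ₜ y))
      (fun b => hT y hy b _)
      (G.φ ∘ₗ mulR d ∘ₗ G.S.symm.toLinearMap ∘ₗ LinearMap.mul' ℂ A ∘ₗ
        G.S.toLinearMap.lTensor A)
      (fun p q hq => by
        have := hq (G.S.symm p * d)
        simpa [S_symm_mul, mul_assoc] using this)
    simp only [LinearMap.comp_apply, G.isAntipode_S.2] at h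
    simpa [hcd] using h
  refine G.eq_zero_of_mul_left _ fun e => ?_
  rw [← sliceR_ε_T₂]
  exact apply_eq_zero_of_sliceR (fun b => G.φ ∘ₗ mulR b) (G.T₂ (e ⊗ₜ a))
    (fun b => hT a ha b e) (sliceR G.ε) fun p q hq => by simp [hε q hq]

lemma ext_φ_left {x y : A} (h : ∀ b, G.φ (b * x) = G.φ (b * y)) : x = y :=
  sub_eq_zero.1 <| G.eq_zero_of_φ_mul_left fun b => by rw [mul_sub, map_sub, h, sub_self]

lemma ext_φ_right {x y : A} (h : ∀ b, G.φ (x * b) = G.φ (y * b)) : x = y :=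
  sub_eq_zero.1 <| G.eq_zero_of_φ_mul_right fun b => by rw [sub_mul, map_sub, h, sub_self]

end AlgebraicQuantumGroup

/-! ### Uniqueness of modular automorphisms of faithful functionals -/

section Modular

variable {A : Type*} [NonUnitalRing A] [Module ℂ A]

lemma isModularAutomorphism_of_faithful {f : A →ₗ[ℂ] ℂ} (hf : ∀ a, (∀ b, f (b * a) = 0) → a = 0)
    {σ : A ≃ₗ[ℂ] A} (hσ : ∀ a b, f (a * b) = f (b * σ a)) : IsModularAutomorphism f σ := by
  refine ⟨fun a b => sub_eq_zero.1 <| hf _ fun x => ?_, hσ⟩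
  rw [mul_sub, map_sub, ← hσ, mul_assoc, hσ, mul_assoc, hσ, mul_assoc, sub_self]

lemma isModularAutomorphism_unique {f : A →ₗ[ℂ] ℂ} (hf : ∀ a, (∀ b, f (b * a) = 0) → a = 0)
    {σ σ' : A ≃ₗ[ℂ] A} (hσ : ∀ a b, f (a * b) = f (b * σ a))
    (hσ' : ∀ a b, f (a * b) = f (b * σ' a)) : σ = σ' :=
  LinearEquiv.ext fun a => sub_eq_zero.1 <| hf _ fun x => by
    rw [mul_sub, map_sub, ← hσ, hσ', sub_self]

lemma modularAutomorphism_eq [SMulCommClass ℂ A A] [IsScalarTower ℂ A A]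
    {f : A →ₗ[ℂ] ℂ} (hf : ∀ a, (∀ b, f (b * a) = 0) → a = 0)
    {σ : A ≃ₗ[ℂ] A} (hσ : ∀ a b, f (a * b) = f (b * σ a)) : modularAutomorphism f = σ :=
  isModularAutomorphism_unique hf
    (Classical.epsilon_spec (p := IsModularAutomorphism f)
      ⟨σ, isModularAutomorphism_of_faithful hf hσ⟩).2 hσ

end Modular

/-! ### Translates of functionals and invertible multipliers -/

section FunctionalMul

variable {A : Type*} [NonUnitalRing A] [Module ℂ A] [SMulCommClass ℂ A A] [IsScalarTower ℂ A A]

/-- `c ↦ f(· c)`. -/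
def functionalMulR (f : A →ₗ[ℂ] ℂ) : A →ₗ[ℂ] (A →ₗ[ℂ] ℂ) := (LinearMap.mul ℂ A).flip.compr₂ f

/-- `c ↦ f(c ·)`. -/
def functionalMulL (f : A →ₗ[ℂ] ℂ) : A →ₗ[ℂ] (A →ₗ[ℂ] ℂ) := (LinearMap.mul ℂ A).compr₂ f

@[simp] lemma functionalMulR_apply (f : A →ₗ[ℂ] ℂ) (c x : A) :
    functionalMulR f c x = f (x * c) := rfl

@[simp] lemma functionalMulL_apply (f : A →ₗ[ℂ] ℂ) (c x : A) :
    functionalMulL f c x = f (c * x) := rfl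

namespace Multiplier

lemma ext {m n : Multiplier A} (hl : ∀ a, m.lmul a = n.lmul a) (hr : ∀ a, m.rmul a = n.rmul a) :
    m = n :=
  Subtype.ext (Prod.ext (LinearMap.ext hl) (MulOpposite.unop_injective (LinearMap.ext hr)))

@[simp] lemma rmul_mul (m n : Multiplier A) (b : A) : (m * n).rmul b = n.rmul (m.rmul b) := rfl

/-- An invertible multiplier, from its left and right action. -/
def unitOfEquiv (L R : A ≃ₗ[ℂ] A) (h : ∀ a b, a * L b = R a * b) : (Multiplier A)ˣ where
  val := ⟨(L.toLinearMap, MulOpposite.op R.toLinearMap), h⟩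
  inv := ⟨(L.symm.toLinearMap, MulOpposite.op R.symm.toLinearMap), fun a b => by
    have := h (R.symm a) (L.symm b)
    simpa using this.symm⟩
  val_inv := ext (fun a => L.apply_symm_apply a) fun a => R.symm_apply_apply a
  inv_val := ext (fun a => L.symm_apply_apply a) fun a => R.apply_symm_apply a

end Multiplier

end FunctionalMul

lemma rTensor_smulRight {A : Type*} [AddCommGroup A] [Module ℂ A] (f : A →ₗ[ℂ] ℂ) (q : A)
    (t : A ⊗[ℂ] A) : (f.smulRight q).rTensor A t = q ⊗ₜ sliceL f t := by
  induction t with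
  | zero => simp
  | add s t hs ht => simp only [map_add, TensorProduct.tmul_add, hs, ht]
  | tmul a n => simp [TensorProduct.smul_tmul]

namespace AlgebraicQuantumGroup

variable {A : Type*} [NonUnitalRing A] [Module ℂ A] [SMulCommClass ℂ A A] [IsScalarTower ℂ A A]
  (G : AlgebraicQuantumGroup A)

/-! ### Comparison of invariant functionals -/

variable {G}

lemma IsRightInvariant.sliceL_T₄ {f : A →ₗ[ℂ] ℂ} (hf : G.IsRightInvariant f) (a b : A) :
    sliceL f (G.T₄ (b ⊗ₜ a)) = f a • b := by
  refine ext_mul G fun e => ?_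
  have h := congrArg (sliceL f) (G.lTensor_T₄ a e b)
  rw [sliceL_lTensor, sliceL_lTensor, hf] at h
  simpa [mul_smul_comm, smul_mul_assoc] using h

variable (G)

lemma mul_T₄ (a b : A) (t : A ⊗[ℂ] A) :
    t * G.T₄ (a ⊗ₜ b) = (G.Δ b).rmul ((mulR a).lTensor A t) := by
  have h := congrArg (fun m => m.rmul t) (G.T₄_spec a b)
  have h2 : (Multiplier.tmul 1 (Multiplier.of a)).rmul t = (mulR a).lTensor A t := by
    clear h
    induction t with
    | zero => simp
    | add s t hs ht => simp only [map_add, hs, ht]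
    | tmul p q => rfl
  rw [← h2]
  exact h

lemma rmul_T₄ (a p q : A) : (G.Δ a).rmul (G.T₄ (p ⊗ₜ q)) = G.T₄ (p ⊗ₜ (q * a)) := by
  refine sub_eq_zero.1 <| G.eq_zero_of_tmul_mul _ fun x y => ?_
  rw [mul_sub, ← G.rmul_mul_assoc, mul_T₄, mul_T₄, map_mul, sub_eq_zero]
  rfl

variable {G}

lemma IsLeftInvariant.apply_sliceR_lmul_T₃ {f : A →ₗ[ℂ] ℂ} (hf : G.IsLeftInvariant f)
    (g : A →ₗ[ℂ] ℂ) (x : A) (s : A ⊗[ℂ] A) :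
    g (sliceR f ((G.Δ x).lmul (G.T₃ s))) = f (x * sliceR g s) := by
  induction s with
  | zero => simp
  | add s t hs ht => simp only [map_add, mul_add, hs, ht]
  | tmul p q => rw [lmul_T₃, hf.sliceR_T₃]; simp [mul_comm, mul_smul_comm]

/-- Evaluate (g ⊗ f)(Δ(x)t) in two ways. Writing t through `T₃`, left invariance gives f(xc);
writing it through `T₁`, right invariance gives g(xd). As t varies, c and d each run through all of
A. -/
lemma range_functionalMulR_eq {f g : A →ₗ[ℂ] ℂ} (hf : G.IsLeftInvariant f)
    (hg : G.IsRightInvariant g) (hf0 : f ≠ 0) (hg0 : g ≠ 0) :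
    LinearMap.range (functionalMulR f) = LinearMap.range (functionalMulR g) := by
  refine range_eq_of_comp_eq _ _ (sliceR g)
    (sliceR f ∘ₗ G.T₁.symm.toLinearMap ∘ₗ G.T₃.toLinearMap) (sliceR_surjective hg0)
    ((sliceR_surjective hf0).comp (G.T₁.symm.surjective.comp G.T₃.surjective)) ?_
  refine LinearMap.ext fun s => LinearMap.ext fun x => ?_
  have h2 : ∀ s, g (sliceR f ((G.Δ x).lmul (G.T₁ s))) = g (x * sliceR f s) := by
    intro s
    induction s with
    | zero => simp
    | add s t hs ht => simp only [map_add, mul_add, hs, ht]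
    | tmul p q => rw [lmul_T₁, ← apply_sliceL, hg]; simp [mul_comm, mul_smul_comm]
  have h3 := h2 (G.T₁.symm (G.T₃ s))
  rw [LinearEquiv.apply_symm_apply, hf.apply_sliceR_lmul_T₃] at h3
  simpa using h3

lemma range_functionalMulL_eq {f g : A →ₗ[ℂ] ℂ} (hf : G.IsLeftInvariant f)
    (hg : G.IsRightInvariant g) (hf0 : f ≠ 0) (hg0 : g ≠ 0) :
    LinearMap.range (functionalMulL f) = LinearMap.range (functionalMulL g) := by
  refine range_eq_of_comp_eq _ _ (sliceL g)
    (sliceL f ∘ₗ G.T₄.symm.toLinearMap ∘ₗ G.T₂.toLinearMap) (sliceL_surjective hg0)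
    ((sliceL_surjective hf0).comp (G.T₄.symm.surjective.comp G.T₂.surjective)) ?_
  refine LinearMap.ext fun s => LinearMap.ext fun x => ?_
  have h1 : ∀ s, g (sliceR f ((G.Δ x).rmul (G.T₂ s))) = f (sliceL g s * x) := by
    intro s
    induction s with
    | zero => simp
    | add s t hs ht => simp only [map_add, add_mul, hs, ht]
    | tmul p q => rw [rmul_T₂, hf]; simp [mul_comm, smul_mul_assoc]
  have h2 : ∀ s, g (sliceR f ((G.Δ x).rmul (G.T₄ s))) = g (sliceL f s * x) := by
    intro s
    induction s with
    | zero => simp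
    | add s t hs ht => simp only [map_add, add_mul, hs, ht]
    | tmul p q => rw [rmul_T₄, ← apply_sliceL, hg.sliceL_T₄]; simp [mul_comm, smul_mul_assoc]
  have h3 := h2 (G.T₄.symm (G.T₂ s))
  rw [LinearEquiv.apply_symm_apply, h1] at h3
  simpa using h3

variable (G)

lemma comp_equiv_ne_zero {A : Type*} [AddCommGroup A] [Module ℂ A] {f : A →ₗ[ℂ] ℂ} (hf : f ≠ 0) (e : A ≃ₗ[ℂ] A) :
    f ∘ₗ e.toLinearMap ≠ 0 := fun h => hf <| LinearMap.ext fun x => by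
  simpa using LinearMap.congr_fun h (e.symm x)

lemma ψ_ne_zero : G.ψ ≠ 0 := comp_equiv_ne_zero G.φ_ne_zero _

lemma functionalMulR_φ_injective : Function.Injective (functionalMulR G.φ) :=
  fun _ _ h => G.ext_φ_left fun b => LinearMap.congr_fun h b

lemma functionalMulL_φ_injective : Function.Injective (functionalMulL G.φ) :=
  fun _ _ h => G.ext_φ_right fun b => LinearMap.congr_fun h b

lemma functional_ext (G : AlgebraicQuantumGroup A) {f g : A →ₗ[ℂ] ℂ}
    (h : ∀ a b, f (a * b) = g (a * b)) : f = g := by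
  refine LinearMap.ext fun x => ?_
  obtain ⟨t, rfl⟩ := (sliceL_surjective G.ε_ne_zero).comp G.T₁.surjective x
  induction t with
  | zero => simp
  | add s t hs ht =>
    simp only [Function.comp_apply, map_add] at hs ht ⊢
    rw [hs, ht]
  | tmul p q => simp [sliceL_ε_T₁, h]

variable {G}

/-- Left integrals are unique up to a scalar. -/
lemma IsLeftInvariant.exists_eq_smul {f : A →ₗ[ℂ] ℂ} (hf : G.IsLeftInvariant f) :
    ∃ k : ℂ, f = k • G.φ := by
  by_cases hf0 : f = 0
  · exact ⟨0, by simp [hf0]⟩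
  have hr : LinearMap.range (functionalMulR f) = LinearMap.range (functionalMulR G.φ) :=
    (range_functionalMulR_eq hf G.isRightInvariant_ψ hf0 G.ψ_ne_zero).trans
      (range_functionalMulR_eq G.isLeftInvariant_φ G.isRightInvariant_ψ G.φ_ne_zero
        G.ψ_ne_zero).symm
  -- R is the density of f relative to φ. The rest shows that it commutes with Δ on the right leg,
  -- and applying the counit then makes it a scalar.
  obtain ⟨R, hR⟩ : ∃ R : A →ₗ[ℂ] A, ∀ x b, G.φ (x * R b) = f (x * b) := by
    let e := LinearEquiv.ofInjective _ G.functionalMulR_φ_injective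
    refine ⟨e.symm.toLinearMap ∘ₗ (functionalMulR f).codRestrict _
      fun b => hr ▸ LinearMap.mem_range_self _ b, fun x b => ?_⟩
    have := LinearEquiv.apply_symm_apply e ((functionalMulR f).codRestrict _
      (fun b => hr ▸ LinearMap.mem_range_self _ b) b)
    exact LinearMap.congr_fun (congrArg Subtype.val this) x
  have hmul : ∀ c b, R (c * b) = c * R b := fun c b => G.ext_φ_left fun x => by
    rw [hR, ← mul_assoc, ← mul_assoc, hR]
  have h1 : ∀ a b, sliceR G.φ (G.T₁ (a ⊗ₜ R b)) = sliceR f (G.T₁ (a ⊗ₜ b)) := by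
    intro a b
    refine G.ext_mul_left fun e => ?_
    have h := congrArg (sliceR G.φ) (G.lTensor_T₂ a (R b) e)
    have h' := congrArg (sliceR f) (G.lTensor_T₂ a b e)
    rw [sliceR_rTensor, sliceR_lTensor] at h h'
    have : G.φ ∘ₗ mulR (R b) = f ∘ₗ mulR b := LinearMap.ext fun x => hR x b
    rw [this] at h
    exact h.symm.trans h'
  -- The antipode formula holds for f and for φ with the same S, so h1 passes from slices of `T₁` to
  -- slices of `T₄`; faithfulness of φ removes the slice.
  have h2 : ∀ e b, R.lTensor A (G.T₂ (e ⊗ₜ b)) = G.T₂ (e ⊗ₜ R b) := by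
    intro e b
    refine tensor_eq_of_sliceR (fun a => G.φ ∘ₗ mulL a) (fun a h => G.eq_zero_of_φ_mul_left h)
      fun a => ?_
    have h3 : (G.φ ∘ₗ mulL a) ∘ₗ R = f ∘ₗ mulL a := LinearMap.ext fun x => hR a x
    rw [sliceR_lTensor, h3, ← sliceR_lTensor, ← sliceR_lTensor, lTensor_mulL_T₂, lTensor_mulL_T₂,
      sliceR_rTensor, sliceR_rTensor, ← G.isLeftInvariant_φ.S_sliceR_T₁, h1, hf.S_sliceR_T₁]
  have h4 : ∀ s, sliceR (G.ε ∘ₗ R) s = R (sliceR G.ε s) := by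
    intro s
    obtain ⟨s, rfl⟩ := G.T₂.surjective s
    induction s with
    | zero => simp
    | add s t hs ht => simp only [map_add, hs, ht]
    | tmul p q => rw [← sliceR_lTensor, h2, sliceR_ε_T₂, sliceR_ε_T₂, hmul]
  obtain ⟨v, hv⟩ : ∃ v, G.ε v ≠ 0 := by
    by_contra! h
    exact G.ε_ne_zero (LinearMap.ext h)
  refine ⟨(G.ε v)⁻¹ * G.ε (R v), G.functional_ext fun x u => ?_⟩
  have h5 : R u = ((G.ε v)⁻¹ * G.ε (R v)) • u := by
    have := h4 (u ⊗ₜ v)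
    simp only [sliceR_tmul, LinearMap.comp_apply, map_smul] at this
    rw [mul_smul, this, smul_smul, inv_mul_cancel₀ hv, one_smul]
  rw [← hR, h5, mul_smul_comm, map_smul, LinearMap.smul_apply]

variable (G)

/-! ### The modular automorphisms -/

lemma S_sliceL_ψ (t : A ⊗[ℂ] A) : G.S (sliceL G.ψ t) = sliceL G.φ (G.SS t) :=
  (sliceL_map G.φ G.S.toLinearMap G.S.toLinearMap t).symm

/-- The mirror image, for the right integral, of the slice formula for S; it is obtained by applying
S and reversing the coproduct. -/
lemma S_sliceL_ψ_T₂ (a x : A) :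
    G.S (sliceL G.ψ (G.T₂ (a ⊗ₜ x))) = sliceL G.ψ (G.T₃ (a ⊗ₜ x)) := by
  apply G.S.injective
  rw [S_sliceL_ψ, S_sliceL_ψ, SS_T₂, SS_T₃, sliceL_comm, sliceL_comm,
    G.isLeftInvariant_φ.S_sliceR_T₁]

/-- Both slice formulas for S are chained: φ(xb₂)φ(b₁S(a)) = ψ(ax₁)φ(x₂b) = φ(S⁻¹(S(b)a₂))ψ(a₁x).
The outcome moves x from the right end of one product to the left end of another, which is what
produces a modular automorphism. -/
lemma φ_mul_sliceL_T₃ (a b x : A) : G.φ (x * sliceL G.φ (G.T₃ (b ⊗ₜ G.S a))) =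
    G.ψ (sliceR (G.φ ∘ₗ G.S.symm.toLinearMap) (G.T₄ (G.S b ⊗ₜ a)) * x) := by
  have h1 : G.φ (x * sliceL G.φ (G.T₃ (b ⊗ₜ G.S a))) =
      G.φ (sliceR G.φ (G.T₄ (x ⊗ₜ b)) * G.S a) := by
    have h := congrArg (fun t => G.φ (sliceR G.φ t)) (G.rTensor_T₄ b (G.S a) x)
    simp only [sliceR_rTensor] at h
    rw [← apply_sliceL, sliceL_lTensor] at h
    exact h.symm
  have h2 : G.φ (sliceR G.φ (G.T₄ (x ⊗ₜ b)) * G.S a) =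
      G.φ (sliceL G.ψ (G.T₂ (a ⊗ₜ x)) * b) := by
    rw [← G.isLeftInvariant_φ.S_sliceR_T₁, ← S_mul]
    have h := congrArg (fun t => G.ψ (sliceR G.φ t)) (G.lTensor_T₂ x b a)
    simp only [sliceR_rTensor] at h
    rw [← apply_sliceL, sliceL_lTensor] at h
    exact h.symm
  have h3 := congrArg (fun t => G.ψ (sliceR (G.φ ∘ₗ G.S.symm.toLinearMap) t))
    (G.rTensor_T₄ a x (G.S b))
  simp only [sliceR_rTensor] at h3
  rw [← apply_sliceL, sliceL_lTensor, ← S_sliceL_ψ_T₂] at h3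
  simp only [LinearMap.flip_apply, LinearMap.mul_apply', ← S_mul, LinearMap.comp_apply,
    LinearEquiv.coe_coe, LinearEquiv.symm_apply_apply] at h3
  rw [h1, h2, ← h3]

lemma range_functionalMulR_φ_eq_functionalMulL_ψ :
    LinearMap.range (functionalMulR G.φ) = LinearMap.range (functionalMulL G.ψ) := by
  let eS := G.S.lTensor A
  let eS' := G.S.rTensor A
  refine range_eq_of_comp_eq _ _ (sliceL G.φ ∘ₗ (eS.trans G.T₃).toLinearMap)
    (sliceR (G.φ ∘ₗ G.S.symm.toLinearMap) ∘ₗ (eS'.trans G.T₄).toLinearMap)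
    ((sliceL_surjective G.φ_ne_zero).comp (eS.trans G.T₃).surjective)
    ((sliceR_surjective (comp_equiv_ne_zero G.φ_ne_zero _)).comp (eS'.trans G.T₄).surjective) ?_
  refine TensorProduct.ext' fun b a => LinearMap.ext fun x => ?_
  exact G.φ_mul_sliceL_T₃ a b x

/-- The functionals φ(a ·) are the ψ(c ·) by uniqueness-type comparison, and those are the φ(· d).
Faithfulness makes a ↦ d a well-defined bijection. -/
lemma isModularAutomorphism_σ : IsModularAutomorphism G.φ G.σ := by
  obtain ⟨e, he⟩ := exists_linearEquiv_of_range_eq (functionalMulL G.φ) (functionalMulR G.φ)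
    G.functionalMulL_φ_injective G.functionalMulR_φ_injective
    ((range_functionalMulL_eq G.isLeftInvariant_φ G.isRightInvariant_ψ G.φ_ne_zero
      G.ψ_ne_zero).trans G.range_functionalMulR_φ_eq_functionalMulL_ψ.symm)
  exact Classical.epsilon_spec (p := IsModularAutomorphism G.φ)
    ⟨e, isModularAutomorphism_of_faithful (fun a h => G.eq_zero_of_φ_mul_left h)
      fun a b => (LinearMap.congr_fun (he a) b).symm⟩

lemma σ_mul (a b : A) : G.σ (a * b) = G.σ a * G.σ b := G.isModularAutomorphism_σ.1 a b

lemma σ_symm_mul (a b : A) : G.σ.symm (a * b) = G.σ.symm a * G.σ.symm b :=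
  G.σ.injective (by simp [σ_mul])

lemma φ_mul_comm (a b : A) : G.φ (a * b) = G.φ (b * G.σ a) := G.isModularAutomorphism_σ.2 a b

lemma φ_mul_σ_symm (a b : A) : G.φ (a * b) = G.φ (G.σ.symm b * a) := by
  rw [φ_mul_comm (a := G.σ.symm b), LinearEquiv.apply_symm_apply]

lemma ψ_apply (a : A) : G.ψ a = G.φ (G.S a) := rfl

lemma eq_zero_of_ψ_mul_left {a : A} (h : ∀ b, G.ψ (b * a) = 0) : a = 0 := by
  rw [← map_eq_zero_iff _ G.S.injective]
  refine G.eq_zero_of_φ_mul_right fun b => ?_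
  have := h (G.S.symm b)
  simpa [ψ_apply, S_mul] using this

lemma ψ_mul_comm (a b : A) : G.ψ (a * b) = G.ψ (b * G.S.symm (G.σ.symm (G.S a))) := by
  simp only [ψ_apply, S_mul, LinearEquiv.apply_symm_apply]
  rw [G.φ_mul_σ_symm]

lemma isModularAutomorphism_σ' : IsModularAutomorphism G.ψ G.σ' :=
  Classical.epsilon_spec (p := IsModularAutomorphism G.ψ)
    ⟨G.S.trans (G.σ.symm.trans G.S.symm),
      isModularAutomorphism_of_faithful (fun _ h => G.eq_zero_of_ψ_mul_left h) G.ψ_mul_comm⟩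

lemma σ'_apply (a : A) : G.σ' a = G.S.symm (G.σ.symm (G.S a)) :=
  LinearEquiv.congr_fun (modularAutomorphism_eq (σ := G.S.trans (G.σ.symm.trans G.S.symm))
    (fun _ h => G.eq_zero_of_ψ_mul_left h) G.ψ_mul_comm) a

lemma σ'_symm_apply (a : A) : G.σ'.symm a = G.S.symm (G.σ (G.S a)) := by
  rw [LinearEquiv.symm_apply_eq, σ'_apply]; simp

end AlgebraicQuantumGroup

namespace AlgebraicQuantumGroup

variable {A : Type*} [NonUnitalRing A] [Module ℂ A] [SMulCommClass ℂ A A] [IsScalarTower ℂ A A]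

/-! ### The modular element -/

lemma lmul_mul (G : AlgebraicQuantumGroup A) (m : Multiplier A) (a b : A) :
    m.lmul (a * b) = m.lmul a * b :=
  G.ext_mul_left fun e => by rw [m.compat, ← mul_assoc, ← mul_assoc, m.compat]

lemma rmul_mul (G : AlgebraicQuantumGroup A) (m : Multiplier A) (a b : A) :
    m.rmul (a * b) = a * m.rmul b :=
  ext_mul G fun e => by rw [← m.compat, mul_assoc, mul_assoc, ← m.compat]

variable (G : AlgebraicQuantumGroup A)

/-- Apply ι ⊗ φ ⊗ ω to coassociativity: invariance of φ in the middle leg removes the first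
coproduct. -/
lemma isLeftInvariant_sliceL_T₁ (ω : A →ₗ[ℂ] ℂ) (e : A) : G.IsLeftInvariant
    (ω ∘ₗ sliceL G.φ ∘ₗ G.T₁.toLinearMap ∘ₗ (TensorProduct.mk ℂ A A).flip e) := by
  intro x y
  have h := congrArg (fun t => sliceR ω ((sliceL G.φ).lTensor A t)) (G.T₂Leg_T₁ y (x ⊗ₜ e))
  have h1 : sliceR G.φ ∘ₗ G.T₂.toLinearMap ∘ₗ TensorProduct.mk ℂ A A y = G.φ.smulRight y :=
    LinearMap.ext fun b => G.isLeftInvariant_φ b y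
  simp only [lTensor_sliceL_T₂Leg, h1, rTensor_smulRight, sliceR_tmul] at h
  rw [← LinearMap.comp_apply (LinearMap.lTensor A _), ← LinearMap.lTensor_comp, lTensor_T₂Leg,
    sliceR_lTensor] at h
  exact h.symm

/-- Uniqueness of left integrals gives (φ ⊗ ι)Δ(a) = φ(a)δ. Applying φ to the slice formula for S,
together with right invariance of φS and of φS⁻¹, yields the two defining relations; invertibility
comes from faithfulness and from the equality of the spaces of translated functionals. -/
lemma exists_isModularElement : ∃ δ, IsModularElement G.S G.φ δ ∧
    ∀ a e, sliceL G.φ (G.T₁ (a ⊗ₜ e)) = G.φ a • (δ : Multiplier A).lmul e := by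
  obtain ⟨a₀, ha₀⟩ : ∃ a, G.φ a = 1 := by
    obtain ⟨a, ha⟩ : ∃ a, G.φ a ≠ 0 := by
      by_contra! h
      exact G.φ_ne_zero (LinearMap.ext h)
    exact ⟨(G.φ a)⁻¹ • a, by simp [ha]⟩
  let L : A →ₗ[ℂ] A := sliceL G.φ ∘ₗ G.T₁.toLinearMap ∘ₗ TensorProduct.mk ℂ A A a₀
  let R : A →ₗ[ℂ] A := sliceL G.φ ∘ₗ G.T₄.toLinearMap ∘ₗ (TensorProduct.mk ℂ A A).flip a₀
  have hL : ∀ a e, sliceL G.φ (G.T₁ (a ⊗ₜ e)) = G.φ a • L e := by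
    intro a e
    rw [← sub_eq_zero, ← Module.forall_dual_apply_eq_zero_iff ℂ]
    intro ω
    obtain ⟨k, hk⟩ := (G.isLeftInvariant_sliceL_T₁ ω e).exists_eq_smul
    have h1 := LinearMap.congr_fun hk a
    have h2 := LinearMap.congr_fun hk a₀
    simp only [LinearMap.smul_apply, ha₀, smul_eq_mul, mul_one] at h1 h2
    rw [← h2] at h1
    rw [map_sub, map_smul, smul_eq_mul, mul_comm, sub_eq_zero]
    exact h1
  have hLR : ∀ a b, a * L b = R a * b := by
    intro a b
    have h := congrArg (sliceL G.φ) (G.lTensor_T₄ a₀ b a)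
    rw [sliceL_lTensor, sliceL_lTensor] at h
    exact h.symm
  have hR : ∀ a e, sliceL G.φ (G.T₄ (e ⊗ₜ a)) = G.φ a • R e := by
    intro a e
    refine ext_mul G fun c => ?_
    have h := congrArg (sliceL G.φ) (G.lTensor_T₄ a c e)
    rw [sliceL_lTensor, sliceL_lTensor, hL] at h
    rw [smul_mul_assoc, ← hLR, ← mul_smul_comm]
    exact h
  have hψ : ∀ a, G.φ (G.S a) = G.φ (R a) := by
    intro a
    have h := congrArg G.φ (G.isLeftInvariant_φ.S_sliceR_T₁ (a ⊗ₜ a₀))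
    rw [← G.ψ_apply, ← apply_sliceL, ← apply_sliceL, G.isRightInvariant_ψ, hR] at h
    simpa [ha₀, ψ_apply] using h
  have hψ' : ∀ a, G.φ (G.S.symm a) = G.φ (L a) := by
    intro a
    have h : (G.φ ∘ₗ G.S.symm.toLinearMap) (sliceR G.φ (G.T₄ (a₀ ⊗ₜ a))) =
        G.φ (sliceR G.φ (G.T₁ (a₀ ⊗ₜ a))) := by
      rw [← G.isLeftInvariant_φ.S_sliceR_T₁]; simp
    rw [← apply_sliceL, ← apply_sliceL, G.isLeftInvariant_φ.comp_S_symm.sliceL_T₄, hL] at h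
    simpa [ha₀] using h
  have hLm : ∀ a b, L (a * b) = L a * b := fun a b => G.ext_mul_left fun e => by
    rw [hLR, ← mul_assoc, ← mul_assoc, hLR]
  have hRm : ∀ a b, R (a * b) = a * R b := fun a b => ext_mul G fun e => by
    rw [← hLR, mul_assoc, mul_assoc, ← hLR]
  have h1 : functionalMulR G.φ ∘ₗ R = functionalMulR G.ψ :=
    LinearMap.ext fun a => LinearMap.ext fun x => by
      simp [← hRm, ← hψ, ψ_apply]
  have h2 : functionalMulL G.φ ∘ₗ L = functionalMulL (G.φ ∘ₗ G.S.symm.toLinearMap) :=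
    LinearMap.ext fun a => LinearMap.ext fun x => by
      simp [← hLm, ← hψ']
  have hRb : Function.Bijective R := by
    constructor
    · refine (injective_iff_map_eq_zero R).2 fun a ha => G.eq_zero_of_ψ_mul_left fun b => ?_
      rw [ψ_apply, hψ, hRm, ha]; simp
    · intro y
      have hy : functionalMulR G.φ y ∈ LinearMap.range (functionalMulR G.ψ) :=
        range_functionalMulR_eq G.isLeftInvariant_φ G.isRightInvariant_ψ G.φ_ne_zero
          G.ψ_ne_zero ▸ LinearMap.mem_range_self _ y
      obtain ⟨a, ha⟩ := hy
      exact ⟨a, G.functionalMulR_φ_injective (by rw [← ha, ← h1]; rfl)⟩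
  have hLb : Function.Bijective L := by
    constructor
    · refine (injective_iff_map_eq_zero L).2 fun a ha => ?_
      rw [← map_eq_zero_iff _ G.S.symm.injective]
      refine G.eq_zero_of_φ_mul_left fun b => ?_
      rw [← G.S.symm_apply_apply b, ← S_symm_mul, hψ', hLm, ha]; simp
    · intro y
      have hy : functionalMulL G.φ y ∈
          LinearMap.range (functionalMulL (G.φ ∘ₗ G.S.symm.toLinearMap)) :=
        range_functionalMulL_eq G.isLeftInvariant_φ G.isLeftInvariant_φ.comp_S_symm G.φ_ne_zero
          (comp_equiv_ne_zero G.φ_ne_zero _) ▸ LinearMap.mem_range_self _ y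
      obtain ⟨a, ha⟩ := hy
      exact ⟨a, G.functionalMulL_φ_injective (by rw [← ha, ← h2]; rfl)⟩
  exact ⟨Multiplier.unitOfEquiv (LinearEquiv.ofBijective L hLb) (LinearEquiv.ofBijective R hRb) hLR,
    fun a => ⟨hψ a, hψ' a⟩, hL⟩

lemma isModularElement_δ : IsModularElement G.S G.φ G.δ :=
  Classical.epsilon_spec (p := IsModularElement G.S G.φ)
    (G.exists_isModularElement.imp fun _ h => h.1)

/-- `x ↦ δ x`. -/
noncomputable def δL : A ≃ₗ[ℂ] A :=
  LinearEquiv.ofLinearMap (G.δ : Multiplier A).lmul (↑G.δ⁻¹ : Multiplier A).lmul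
    (LinearMap.ext fun x => by
      rw [LinearMap.comp_apply, ← Multiplier.lmul_mul, Units.mul_inv]; rfl)
    (LinearMap.ext fun x => by
      rw [LinearMap.comp_apply, ← Multiplier.lmul_mul, Units.inv_mul]; rfl)

/-- `x ↦ x δ`. -/
noncomputable def δR : A ≃ₗ[ℂ] A :=
  LinearEquiv.ofLinearMap (G.δ : Multiplier A).rmul (↑G.δ⁻¹ : Multiplier A).rmul
    (LinearMap.ext fun x => by
      rw [LinearMap.comp_apply, ← Multiplier.rmul_mul, Units.inv_mul]; rfl)
    (LinearMap.ext fun x => by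
      rw [LinearMap.comp_apply, ← Multiplier.rmul_mul, Units.mul_inv]; rfl)

lemma δL_symm_apply (x : A) : G.δL.symm x = (↑G.δ⁻¹ : Multiplier A).lmul x := rfl

lemma mul_δL (a b : A) : a * G.δL b = G.δR a * b := Multiplier.compat _ a b
lemma δL_mul (a b : A) : G.δL (a * b) = G.δL a * b := G.lmul_mul _ a b
lemma δR_mul (a b : A) : G.δR (a * b) = a * G.δR b := G.rmul_mul _ a b
lemma δL_symm_mul (a b : A) : G.δL.symm (a * b) = G.δL.symm a * b := G.lmul_mul _ a b
lemma δR_symm_mul (a b : A) : G.δR.symm (a * b) = a * G.δR.symm b := G.rmul_mul _ a b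

lemma mul_δL_symm (a b : A) : a * G.δL.symm b = G.δR.symm a * b := Multiplier.compat _ a b

lemma δL_δR (x : A) : G.δL (G.δR x) = G.δR (G.δL x) := G.ext_mul_left fun a => by
  rw [mul_δL, ← δR_mul, ← δR_mul, mul_δL]

lemma φ_S (x : A) : G.φ (G.S x) = G.φ (G.δR x) := (G.isModularElement_δ x).1

lemma φ_S_symm (x : A) : G.φ (G.S.symm x) = G.φ (G.δL x) := (G.isModularElement_δ x).2

lemma sliceL_φ_T₁ (a e : A) : sliceL G.φ (G.T₁ (a ⊗ₜ e)) = G.φ a • G.δL e := by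
  obtain ⟨u, hu, h⟩ := G.exists_isModularElement
  have : (u : Multiplier A).lmul e = G.δL e := G.ext_φ_right fun b => by
    rw [← G.lmul_mul, ← (hu _).2, φ_S_symm, δL_mul]
  rw [h, this]

lemma ε_δL (x : A) : G.ε (G.δL x) = G.ε x := by
  obtain ⟨a, ha⟩ : ∃ a, G.φ a ≠ 0 := by
    by_contra! h
    exact G.φ_ne_zero (LinearMap.ext h)
  have h := congrArg G.ε (G.sliceL_φ_T₁ a x)
  rw [apply_sliceL, sliceR_ε_T₁, map_smul, map_smul, smul_eq_mul, smul_eq_mul, mul_comm] at h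
  exact (mul_left_cancel₀ ha h).symm

lemma exists_ε_ne_zero : ∃ a, G.ε a ≠ 0 := by
  by_contra! h
  exact G.ε_ne_zero (LinearMap.ext h)

lemma ε_δR (x : A) : G.ε (G.δR x) = G.ε x := by
  obtain ⟨a, ha⟩ := G.exists_ε_ne_zero
  have h := congrArg G.ε (G.mul_δL x a)
  rw [ε_mul, ε_mul, ε_δL] at h
  exact (mul_right_cancel₀ ha h).symm

lemma ε_δR_symm (x : A) : G.ε (G.δR.symm x) = G.ε x := by
  rw [← ε_δR, LinearEquiv.apply_symm_apply]

/-- That is S(δ⁻¹) = δ: tested against φ, the two defining relations of δ cancel one another. -/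
lemma S_δR_symm (x : A) : G.S (G.δR.symm x) = G.δL (G.S x) := by
  refine G.ext_φ_right fun y => ?_
  obtain ⟨y, rfl⟩ := G.S.surjective y
  rw [← S_mul, ← δL_mul, ← S_mul, ← φ_S_symm, φ_S, δR_mul]
  simp

lemma S_δL_symm (x : A) : G.S (G.δL.symm x) = G.δR (G.S x) := by
  refine ext_mul G fun y => ?_
  obtain ⟨y, rfl⟩ := G.S.surjective y
  rw [← S_mul, mul_δL_symm, S_mul, S_δR_symm, mul_δL]

lemma φ_S_S (x : A) : G.φ (G.S (G.S x)) = G.φ (G.δR (G.δL.symm x)) := by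
  rw [φ_S, ← S_δL_symm, φ_S]

/-! ### The scaling constant -/

lemma exists_scaling : ∃ τ : ℂ, τ ≠ 0 ∧ ∀ x, G.φ (G.S (G.S x)) = τ * G.φ x := by
  obtain ⟨k, hk⟩ := G.isRightInvariant_ψ.comp_S.exists_eq_smul
  have h : ∀ x, G.φ (G.S (G.S x)) = k * G.φ x := fun x => LinearMap.congr_fun hk x
  refine ⟨k, fun hk0 => G.φ_ne_zero (LinearMap.ext fun x => ?_), h⟩
  have := h (G.S.symm (G.S.symm x))
  simpa [hk0] using this

/-- The scaling constant: `φ ∘ S² = τ φ`. -/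
noncomputable def τ : ℂ := G.exists_scaling.choose

lemma τ_ne_zero : G.τ ≠ 0 := G.exists_scaling.choose_spec.1

lemma φ_S_S_eq (x : A) : G.φ (G.S (G.S x)) = G.τ * G.φ x := G.exists_scaling.choose_spec.2 x

lemma φ_δR (x : A) : G.φ (G.δR x) = G.τ * G.φ (G.δL x) := by
  rw [← φ_S_S_eq, φ_S_S, LinearEquiv.symm_apply_apply]

lemma σ_S_S (a : A) : G.σ (G.S (G.S a)) = G.S (G.S (G.σ a)) := by
  refine G.ext_φ_left fun b => ?_
  obtain ⟨b, rfl⟩ := G.S.surjective b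
  obtain ⟨b, rfl⟩ := G.S.surjective b
  rw [← φ_mul_comm, ← S_mul, ← S_mul, ← S_mul, ← S_mul, φ_S_S_eq, φ_S_S_eq, φ_mul_comm]

lemma σ_symm_S_S (a : A) : G.σ.symm (G.S (G.S a)) = G.S (G.S (G.σ.symm a)) := by
  rw [LinearEquiv.symm_apply_eq, σ_S_S, LinearEquiv.apply_symm_apply]

lemma δL_σ (a : A) : G.δL (G.σ a) = G.τ • G.σ (G.δL a) := by
  refine G.ext_φ_left fun b => ?_
  rw [mul_δL, ← φ_mul_comm, ← δR_mul, φ_δR, mul_smul_comm, map_smul, ← φ_mul_comm, δL_mul,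
    smul_eq_mul]

/-- From ψ = φ(· δ), so σ' is σ followed by conjugation by δ. Together with ε(δ) = 1 this links the
two characters ε ∘ σ and ε ∘ σ'. -/
lemma σ'_apply' (a : A) : G.σ' a = G.δR.symm (G.δL (G.σ a)) := by
  have h := isModularAutomorphism_unique (f := G.ψ) (σ := G.σ')
    (σ' := G.σ.trans (G.δL.trans G.δR.symm)) (fun _ h => G.eq_zero_of_ψ_mul_left h)
    G.isModularAutomorphism_σ'.2 fun a b => by
      simp only [ψ_apply, φ_S, LinearEquiv.trans_apply]
      rw [δR_mul, δR_mul, LinearEquiv.apply_symm_apply, φ_mul_comm, mul_δL]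
  exact LinearEquiv.congr_fun h a

/-! ### The coproduct and the modular automorphisms -/

/-- `S²`. -/
noncomputable def S2 : A ≃ₗ[ℂ] A := G.S.trans G.S

lemma S2_apply (a : A) : G.S2 a = G.S (G.S a) := rfl
lemma S2_mul (a b : A) : G.S2 (a * b) = G.S2 a * G.S2 b := by simp [S2_apply, S_mul]

lemma ε_S2 (x : A) : G.ε (G.S2 x) = G.ε x := by rw [S2_apply, ε_S, ε_S]

/-- This is Δ(σ(a)) = (S² ⊗ σ)Δ(a). Slicing with φ(b ·), modularity turns a `T₄` slice into a `T₁`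
slice, and each passage back through the antipode formula costs one S, hence S² in total. -/
lemma map_S2_σ_T₂ (a c : A) : TensorProduct.map G.S2.toLinearMap G.σ.toLinearMap
    (G.T₂ (c ⊗ₜ a)) = G.T₂ (G.S2 c ⊗ₜ G.σ a) := by
  have h0 : ∀ a b, sliceR G.φ (G.T₄ (a ⊗ₜ b)) = sliceR G.φ (G.T₁ (b ⊗ₜ G.σ a)) := by
    intro a b
    refine G.ext_mul_left fun e => ?_
    have h := congrArg (sliceR G.φ) (G.lTensor_mulL_T₂ b e a)
    have h' := congrArg (sliceR G.φ) (G.lTensor_T₂ b (G.σ a) e)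
    rw [sliceR_rTensor, sliceR_lTensor] at h h'
    have : G.φ ∘ₗ mulL a = G.φ ∘ₗ mulR (G.σ a) := LinearMap.ext fun x => G.φ_mul_comm a x
    rw [this] at h
    exact h.symm.trans h'
  refine tensor_eq_of_sliceR (fun b => G.φ ∘ₗ mulL b) (fun b h => G.eq_zero_of_φ_mul_left h)
    fun b => ?_
  have h1 : (G.φ ∘ₗ mulL b) ∘ₗ G.σ.toLinearMap = G.φ ∘ₗ mulR b :=
    LinearMap.ext fun x => (G.φ_mul_comm x b).symm
  rw [sliceR_map, h1, ← sliceR_lTensor, ← sliceR_lTensor, lTensor_T₂, lTensor_mulL_T₂,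
    sliceR_rTensor, sliceR_rTensor]
  simp only [LinearMap.mul_apply', LinearEquiv.coe_coe]
  rw [S2_mul, S2_apply _ (sliceR G.φ _), G.isLeftInvariant_φ.S_sliceR_T₁, h0,
    G.isLeftInvariant_φ.S_sliceR_T₁]

lemma map_S2_σ_T₃ (a c : A) : TensorProduct.map G.S2.toLinearMap G.σ.toLinearMap
    (G.T₃ (a ⊗ₜ c)) = G.T₃ (G.σ a ⊗ₜ G.S2 c) := by
  have h1 : ∀ e t, (mulL (G.S2 e)).rTensor A (TensorProduct.map G.S2.toLinearMap
      G.σ.toLinearMap t) = TensorProduct.map G.S2.toLinearMap G.σ.toLinearMap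
      ((mulL e).rTensor A t) := by
    intro e t
    induction t with
    | zero => simp
    | add s t hs ht => simp only [map_add, hs, ht]
    | tmul p q => simp [S2_mul]
  have h2 : ∀ e t, (mulR (G.S2 e)).rTensor A (TensorProduct.map G.S2.toLinearMap
      G.σ.toLinearMap t) = TensorProduct.map G.S2.toLinearMap G.σ.toLinearMap
      ((mulR e).rTensor A t) := by
    intro e t
    induction t with
    | zero => simp
    | add s t hs ht => simp only [map_add, hs, ht]
    | tmul p q => simp [S2_mul]
  refine G.eq_of_rTensor_mulL fun e => ?_
  obtain ⟨e, rfl⟩ := G.S2.surjective e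
  rw [h1, ← rTensor_T₂, ← rTensor_T₂, ← h2, map_S2_σ_T₂]

lemma map_σ'_symm_S2_T₁ (a c : A) : TensorProduct.map G.σ'.symm.toLinearMap G.S2.toLinearMap
    (G.T₁ (a ⊗ₜ c)) = G.T₁ (G.σ'.symm a ⊗ₜ G.S2 c) := by
  have hSS : Function.Injective G.SS := (TensorProduct.congr G.S G.S).injective
  apply hSS
  have h1 : ∀ t, G.SS (TensorProduct.map G.σ'.symm.toLinearMap G.S2.toLinearMap t) =
      TensorProduct.map G.σ.toLinearMap G.S2.toLinearMap (G.SS t) := by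
    intro t
    induction t with
    | zero => simp
    | add s t hs ht => simp only [map_add, hs, ht]
    | tmul p q => simp [SS_tmul, σ'_symm_apply, S2_apply]
  have h2 : ∀ t, TensorProduct.map G.σ.toLinearMap G.S2.toLinearMap
      (TensorProduct.comm ℂ A A t) = TensorProduct.comm ℂ A A
      (TensorProduct.map G.S2.toLinearMap G.σ.toLinearMap t) := by
    intro t
    induction t with
    | zero => simp
    | add s t hs ht => simp only [map_add, hs, ht]
    | tmul p q => simp
  rw [h1, SS_T₁, SS_T₁, h2, map_S2_σ_T₂, σ'_symm_apply, LinearEquiv.apply_symm_apply]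
  rfl

/-- The character `ε ∘ σ⁻¹`. -/
noncomputable def χ : A →ₗ[ℂ] ℂ := G.ε ∘ₗ G.σ.symm.toLinearMap

lemma χ_apply (x : A) : G.χ x = G.ε (G.σ.symm x) := rfl

lemma χ_mul (x y : A) : G.χ (x * y) = G.χ x * G.χ y := by simp [χ_apply, σ_symm_mul, ε_mul]

lemma χ_σ (x : A) : G.χ (G.σ x) = G.ε x := by simp [χ_apply]

lemma χ_δL (x : A) : G.χ (G.δL x) = G.τ * G.χ x := by
  obtain ⟨x, rfl⟩ := G.σ.surjective x
  rw [δL_σ, map_smul, χ_σ, χ_σ, ε_δL, smul_eq_mul]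

lemma χ_δR (x : A) : G.χ (G.δR x) = G.τ * G.χ x := by
  obtain ⟨a, ha⟩ := G.exists_ε_ne_zero
  have h := congrArg G.χ (G.mul_δL x (G.σ a))
  rw [χ_mul, χ_mul, χ_δL, χ_σ, mul_left_comm, ← mul_assoc] at h
  exact (mul_right_cancel₀ ha h).symm

/-- χ picks up the same nonzero factor τ from δ on the left as on the right, so conjugation by δ is
invisible to it and σ' may be replaced by σ. -/
lemma χ_σ' (x : A) : G.χ (G.σ' x) = G.ε x := by
  have h := G.χ_δR (G.σ' x)
  rw [σ'_apply', LinearEquiv.apply_symm_apply, χ_δL, χ_σ] at h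
  rw [σ'_apply']
  exact (mul_left_cancel₀ G.τ_ne_zero h).symm

lemma ε_σ'_symm (x : A) : G.ε (G.σ'.symm x) = G.χ x := by
  rw [← χ_σ', LinearEquiv.apply_symm_apply]

lemma ε_σ' (x : A) : G.ε (G.σ' x) = G.ε (G.σ x) := by rw [σ'_apply', ε_δR_symm, ε_δL]

lemma χ_S (x : A) : G.χ (G.S x) = G.ε (G.σ x) := by
  have h : ∀ y, G.χ y = G.ε (G.σ (G.S y)) := fun y => by
    rw [← ε_σ'_symm, σ'_symm_apply, ε_S_symm]
  rw [h, σ_S_S, ε_S, ε_S]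

/-- Since χ ∘ σ = ε, slicing the coproduct formula for σ by χ reduces to the counit. This map turns
out to be dual to right multiplication by the dual modular element. -/
lemma sliceR_χ_T₃ (a c : A) : sliceR G.χ (G.T₃ (a ⊗ₜ c)) = G.S2 (G.σ.symm a) * c := by
  obtain ⟨a, rfl⟩ := G.σ.surjective a
  obtain ⟨c, rfl⟩ := G.S2.surjective c
  have h : G.χ ∘ₗ G.σ.toLinearMap = G.ε := LinearMap.ext G.χ_σ
  rw [← map_S2_σ_T₃, sliceR_map, h, sliceR_ε_T₃]
  simp [S2_mul]

lemma sliceR_εσ_T₃ (a c : A) : sliceR (G.ε ∘ₗ G.σ.toLinearMap) (G.T₃ (a ⊗ₜ c)) =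
    G.S2.symm (G.σ a) * c := by
  apply G.S2.injective
  have h := congrArg (sliceR G.ε) (G.map_S2_σ_T₃ a c)
  rw [sliceR_map, sliceR_ε_T₃] at h
  simpa [S2_mul] using h

lemma sliceL_χ_T₁ (a c : A) : sliceL G.χ (G.T₁ (a ⊗ₜ c)) = G.S2.symm (G.σ'.symm a) * c := by
  apply G.S2.injective
  have h := congrArg (sliceL G.ε) (G.map_σ'_symm_S2_T₁ a c)
  have h' : G.ε ∘ₗ G.σ'.symm.toLinearMap = G.χ := LinearMap.ext G.ε_σ'_symm
  rw [sliceL_map, sliceL_ε_T₁, h'] at h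
  simpa [S2_mul] using h

lemma sliceL_εσ_T₁ (a c : A) : sliceL (G.ε ∘ₗ G.σ.toLinearMap) (G.T₁ (a ⊗ₜ c)) =
    G.S2 (G.σ' a) * c := by
  obtain ⟨a, rfl⟩ := G.σ'.symm.surjective a
  obtain ⟨c, rfl⟩ := G.S2.surjective c
  have h : (G.ε ∘ₗ G.σ.toLinearMap) ∘ₗ G.σ'.symm.toLinearMap = G.ε := LinearMap.ext fun x => by
    simp [← ε_σ']
  rw [← map_σ'_symm_S2_T₁, sliceL_map, h, sliceL_ε_T₁]
  simp [S2_mul]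

end AlgebraicQuantumGroup

/-- A modular element of a faithful functional is unique. -/
lemma isModularElement_unique {B : Type*} [NonUnitalRing B] [Module ℂ B] [SMulCommClass ℂ B B]
    [IsScalarTower ℂ B B] {f : B →ₗ[ℂ] ℂ} (hl : ∀ a, (∀ b, f (b * a) = 0) → a = 0)
    (hr : ∀ a, (∀ b, f (a * b) = 0) → a = 0) {S : B ≃ₗ[ℂ] B} {u v : (Multiplier B)ˣ}
    (hu : IsModularElement S f u) (hv : IsModularElement S f v) : u = v := by
  have nl : ∀ x y : B, (∀ e, e * x = e * y) → x = y := fun x y h =>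
    sub_eq_zero.1 <| hl _ fun b => by rw [mul_sub, h, sub_self, map_zero]
  have nr : ∀ x y : B, (∀ e, x * e = y * e) → x = y := fun x y h =>
    sub_eq_zero.1 <| hr _ fun b => by rw [sub_mul, h, sub_self, map_zero]
  have ml : ∀ (m : Multiplier B) (a b : B), m.lmul (a * b) = m.lmul a * b := fun m a b =>
    nl _ _ fun e => by rw [m.compat, ← mul_assoc, ← mul_assoc, m.compat]
  have mr : ∀ (m : Multiplier B) (a b : B), m.rmul (a * b) = a * m.rmul b := fun m a b =>
    nr _ _ fun e => by rw [← m.compat, mul_assoc, mul_assoc, ← m.compat]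
  refine Units.ext (Multiplier.ext (fun a => ?_) fun a => ?_)
  · refine sub_eq_zero.1 <| hr _ fun b => ?_
    rw [sub_mul, map_sub, ← ml, ← ml, ← (hu _).2, ← (hv _).2, sub_self]
  · refine sub_eq_zero.1 <| hl _ fun b => ?_
    rw [mul_sub, map_sub, ← mr, ← mr, ← (hu _).1, ← (hv _).1, sub_self]

namespace AlgebraicQuantumGroup

variable {A : Type*} [NonUnitalRing A] [Module ℂ A] [SMulCommClass ℂ A A] [IsScalarTower ℂ A A]
  (G : AlgebraicQuantumGroup A)

/-! ### The Fourier transform -/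

lemma fourier_injective : Function.Injective G.fourier := G.functionalMulR_φ_injective

/-- `c ↦ φ(· c)` as an isomorphism onto the dual. -/
noncomputable def F : A ≃ₗ[ℂ] G.Dual := LinearEquiv.ofInjective G.fourier G.fourier_injective

lemma F_val (c x : A) : (G.F c).1 x = G.φ (x * c) := rfl

lemma eq_F {b : G.Dual} {c : A} (h : ∀ x, b.1 x = G.φ (x * c)) : b = G.F c := Dual.ext h

lemma rep_F (c : A) : (G.F c).rep = c :=
  G.ext_φ_left fun x => by rw [← Dual.rep_spec, F_val]

lemma actR_F (c a : A) : (G.F c).actR a = sliceL G.φ (G.T₃ (a ⊗ₜ c)) := by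
  change sliceL G.φ (G.T₃ (a ⊗ₜ (G.F c).rep)) = _
  rw [rep_F]

lemma actL_F (c a : A) : (G.F c).actL a = sliceR G.φ (G.T₁ (a ⊗ₜ c)) := by
  change sliceR G.φ (G.T₁ (a ⊗ₜ (G.F c).rep)) = _
  rw [rep_F]

/-- The product is a ↦ (φ ⊗ φ)(Δ(a)(c ⊗ c')). With c ⊗ c' = T₃(s), left invariance collapses it to a
single φ. -/
lemma F_mul_F (c c' : A) : G.F c * G.F c' = G.F (sliceR G.φ (G.T₃.symm (c ⊗ₜ c'))) := by
  refine Dual.ext fun a => ?_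
  rw [Dual.mul_val, actR_F, F_val, F_val, ← G.isLeftInvariant_φ.apply_sliceR_lmul_T₃,
    LinearEquiv.apply_symm_apply, ← slice_slice, ← lTensor_T₃, sliceL_lTensor]
  rfl

variable {G}

lemma Dual.mul_actL (b : G.Dual) (a e : A) : e * b.actL a = sliceR b.1 (G.T₂ (e ⊗ₜ a)) := by
  obtain ⟨c, rfl⟩ := G.F.surjective b
  have h := congrArg (sliceR G.φ) (G.lTensor_T₂ a c e)
  rw [sliceR_lTensor, sliceR_rTensor] at h
  rw [actL_F]
  exact h.symm

lemma Dual.val_actL (b b' : G.Dual) (a : A) : b.1 (b'.actL a) = b'.1 (b.actR a) := by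
  obtain ⟨c, rfl⟩ := G.F.surjective b
  obtain ⟨c', rfl⟩ := G.F.surjective b'
  rw [actL_F, actR_F, F_val, F_val]
  have h := slice_slice G.φ ((G.Δ a).lmul (c ⊗ₜ c'))
  rw [← lTensor_T₃, sliceL_lTensor, lTensor_T₃, ← rTensor_T₁, sliceR_rTensor] at h
  exact h.symm

lemma Dual.actL_actR (b b' : G.Dual) (a : A) : b'.actL (b.actR a) = b.actR (b'.actL a) := by
  obtain ⟨c', rfl⟩ := G.F.surjective b'
  rw [actL_F, actL_F, ← Dual.rTensor_actR, sliceR_rTensor]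

variable (G)

/-! ### The integrals and the antipode of the dual -/

lemma isDualPsi_dualψ : G.IsDualPsi G.dualψ :=
  Classical.epsilon_spec (p := G.IsDualPsi) ⟨G.ε ∘ₗ G.F.symm.toLinearMap, fun c b h => by
    rw [G.eq_F h]; simp⟩

lemma dualψ_F (c : A) : G.dualψ (G.F c) = G.ε c := G.isDualPsi_dualψ c _ fun _ => rfl

lemma S_symm_mul'_T₃ (s : A ⊗[ℂ] A) :
    G.S.symm (LinearMap.mul' ℂ A (G.S.toLinearMap.rTensor A (G.T₃ s))) = sliceL G.ε s := by
  induction s with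
  | zero => simp
  | add s t hs ht => simp only [map_add, hs, ht]
  | tmul p q => rw [mul'_rTensor_S_T₃]; simp

/-- The Plancherel formula. -/
lemma dualψ_F_mul_F (c c' : A) : G.dualψ (G.F c * G.F c') = G.φ (G.S.symm c' * c) := by
  -- The slices by ε and φ are exchanged, and (ε ⊗ ι)T₃⁻¹(c ⊗ c') = S⁻¹(S(c)c') by the antipode
  -- axiom.
  rw [F_mul_F, dualψ_F, ← apply_sliceL, ← S_symm_mul'_T₃, LinearEquiv.apply_symm_apply]
  simp [S_symm_mul]

lemma isDualAntipode_dualS : G.IsDualAntipode G.dualS := by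
  refine Classical.epsilon_spec (p := G.IsDualAntipode)
    ⟨G.F.symm.trans ((G.S.symm.trans (G.σ.trans G.δL)).trans G.F), fun b a => ?_⟩
  obtain ⟨c, rfl⟩ := G.F.surjective b
  simp only [LinearEquiv.trans_apply, LinearEquiv.symm_apply_apply, F_val]
  rw [mul_δL, ← φ_mul_comm, ← δR_mul, ← φ_S, S_mul, LinearEquiv.apply_symm_apply]

lemma dualS_val (b : G.Dual) (a : A) : (G.dualS b).1 a = b.1 (G.S a) :=
  G.isDualAntipode_dualS b a

lemma dualS_F (c : A) : G.dualS (G.F c) = G.F (G.δL (G.σ (G.S.symm c))) := Dual.ext fun a => by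
  rw [dualS_val, F_val, F_val, mul_δL, ← φ_mul_comm, ← δR_mul, ← φ_S, S_mul,
    LinearEquiv.apply_symm_apply]

lemma isDualPhi_dualφ : G.IsDualPhi G.dualφ := by
  refine Classical.epsilon_spec (p := G.IsDualPhi)
    -- The witness is the right integral composed with the inverse dual antipode: ψ(S(·)c) is φ(·
    -- cδ) composed with S, and ε(cδ) = ε(c).
    ⟨G.ε ∘ₗ G.F.symm.toLinearMap ∘ₗ G.dualS.symm.toLinearMap, fun c b h => ?_⟩
  have : b = G.dualS (G.F (G.δR c)) := Dual.ext fun x => by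
    rw [h, dualS_val, F_val, ψ_apply, φ_S, δR_mul]
  rw [this]
  simp [ε_δR]

lemma dualφ_dualS (b : G.Dual) : G.dualφ (G.dualS b) = G.dualψ b := by
  obtain ⟨c, rfl⟩ := G.F.surjective b
  rw [dualψ_F, ← ε_δR_symm]
  refine G.isDualPhi_dualφ _ _ fun x => ?_
  rw [dualS_val, F_val, ψ_apply, φ_S, δR_mul, LinearEquiv.apply_symm_apply]

lemma dualφ_F (c : A) : G.dualφ (G.F c) = G.τ⁻¹ * G.χ c := by
  obtain ⟨c, rfl⟩ := (G.S.symm.trans (G.σ.trans G.δL)).surjective c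
  simp only [LinearEquiv.trans_apply]
  rw [← dualS_F, dualφ_dualS, dualψ_F, χ_δL, χ_σ, ε_S_symm, inv_mul_cancel_left₀ G.τ_ne_zero]

lemma S_actR_dualS (b : G.Dual) (a : A) : G.S ((G.dualS b).actR a) = b.actL (G.S a) := by
  refine G.ext_mul_left fun e => ?_
  obtain ⟨e, rfl⟩ := G.S.surjective e
  have h : (G.dualS b).1 = b.1 ∘ₗ G.S.toLinearMap := LinearMap.ext fun x => G.dualS_val b x
  have h' := sliceL_map b.1 G.S.toLinearMap G.S.toLinearMap (G.T₁ (a ⊗ₜ e))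
  change sliceL b.1 (G.SS _) = _ at h'
  rw [SS_T₁, sliceL_comm] at h'
  rw [← S_mul, Dual.actR_mul, Dual.mul_actL, h]
  exact h'.symm

lemma dualS_mul (b b' : G.Dual) : G.dualS (b * b') = G.dualS b' * G.dualS b :=
  Dual.ext fun a => by
    rw [dualS_val, Dual.mul_val, Dual.mul_val, dualS_val, S_actR_dualS, Dual.val_actL]

lemma eq_zero_of_dualψ_mul_left (b : G.Dual) (h : ∀ b', G.dualψ (b' * b) = 0) : b = 0 := by
  obtain ⟨c, rfl⟩ := G.F.surjective b
  rw [map_eq_zero_iff _ G.F.injective, ← map_eq_zero_iff _ G.S.symm.injective]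
  exact G.eq_zero_of_φ_mul_right fun x => by rw [← dualψ_F_mul_F, h]

lemma eq_zero_of_dualψ_mul_right (b : G.Dual) (h : ∀ b', G.dualψ (b * b') = 0) : b = 0 := by
  obtain ⟨c, rfl⟩ := G.F.surjective b
  rw [map_eq_zero_iff _ G.F.injective]
  refine G.eq_zero_of_φ_mul_left fun x => ?_
  rw [← G.S.symm_apply_apply x, ← dualψ_F_mul_F, h]

lemma eq_zero_of_dualφ_mul_left (b : G.Dual) (h : ∀ b', G.dualφ (b' * b) = 0) : b = 0 := by
  obtain ⟨b, rfl⟩ := G.dualS.surjective b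
  rw [map_eq_zero_iff _ G.dualS.injective]
  exact G.eq_zero_of_dualψ_mul_right _ fun x => by rw [← dualφ_dualS, dualS_mul, h]

lemma eq_zero_of_dualφ_mul_right (b : G.Dual) (h : ∀ b', G.dualφ (b * b') = 0) : b = 0 := by
  obtain ⟨b, rfl⟩ := G.dualS.surjective b
  rw [map_eq_zero_iff _ G.dualS.injective]
  exact G.eq_zero_of_dualψ_mul_left _ fun x => by rw [← dualφ_dualS, dualS_mul, h]

/-! ### The modular automorphisms of the dual -/

lemma S_δL (x : A) : G.S (G.δL x) = G.δR.symm (G.S x) := by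
  rw [LinearEquiv.eq_symm_apply, ← S_δL_symm, LinearEquiv.symm_apply_apply]

/-- The automorphism `φ(· c) ↦ φ(· S²(c) δ⁻¹)`. -/
noncomputable def dualAut : G.Dual ≃ₗ[ℂ] G.Dual :=
  G.F.symm.trans ((G.S2.trans G.δR.symm).trans G.F)

lemma dualAut_F (c : A) : G.dualAut (G.F c) = G.F (G.δR.symm (G.S (G.S c))) := by
  simp [dualAut, S2_apply]

/-- By Plancherel the right side is φ(δS(c)c'), because S²(c)δ⁻¹ = S(δS(c)). The relation φ(δ ·) = φ
∘ S⁻¹ turns it into φ(S⁻¹(c')c). -/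
lemma dualψ_mul_comm (b b' : G.Dual) : G.dualψ (b * b') = G.dualψ (b' * G.dualAut b) := by
  obtain ⟨c, rfl⟩ := G.F.surjective b
  obtain ⟨c', rfl⟩ := G.F.surjective b'
  rw [dualAut_F, dualψ_F_mul_F, dualψ_F_mul_F, ← S_δL, LinearEquiv.symm_apply_apply, ← δL_mul,
    ← φ_S_symm, S_symm_mul, LinearEquiv.symm_apply_apply]

lemma isModularAutomorphism_dualσ' : IsModularAutomorphism G.dualψ G.dualσ' :=
  Classical.epsilon_spec (p := IsModularAutomorphism G.dualψ)
    ⟨_, isModularAutomorphism_of_faithful G.eq_zero_of_dualψ_mul_left G.dualψ_mul_comm⟩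

lemma dualσ'_eq : G.dualσ' = G.dualAut :=
  modularAutomorphism_eq G.eq_zero_of_dualψ_mul_left G.dualψ_mul_comm

lemma dualAut_val (b : G.Dual) (a : A) :
    (G.dualAut b).1 a = b.1 (G.δL.symm (G.S.symm (G.S.symm a))) := by
  obtain ⟨c, rfl⟩ := G.F.surjective b
  obtain ⟨a, rfl⟩ := G.S.surjective a
  obtain ⟨a, rfl⟩ := G.S.surjective a
  rw [dualAut_F, F_val, F_val, LinearEquiv.symm_apply_apply, LinearEquiv.symm_apply_apply,
    ← δR_symm_mul, ← S_mul, ← S_mul, ← δL_symm_mul, ← S_δL, ← S_δR_symm, φ_S_S]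
  congr 1
  generalize a * c = z
  obtain ⟨z, rfl⟩ := G.δR.surjective z
  obtain ⟨z, rfl⟩ := G.δL.surjective z
  rw [LinearEquiv.symm_apply_apply, LinearEquiv.symm_apply_apply, ← δL_δR,
    LinearEquiv.symm_apply_apply]

/-- The dual antipode is anti-multiplicative and exchanges the two integrals, so it conjugates one
modular automorphism into the inverse of the other. -/
lemma dualφ_mul_comm (b b' : G.Dual) : G.dualφ (b * b') =
    G.dualφ (b' * (G.dualS.symm.trans (G.dualAut.symm.trans G.dualS)) b) := by
  obtain ⟨x, rfl⟩ := G.dualS.surjective b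
  obtain ⟨y, rfl⟩ := G.dualS.surjective b'
  simp only [LinearEquiv.trans_apply, LinearEquiv.symm_apply_apply]
  rw [← dualS_mul, ← dualS_mul, dualφ_dualS, dualφ_dualS, G.dualψ_mul_comm _ y,
    LinearEquiv.apply_symm_apply]

lemma isModularAutomorphism_dualσ : IsModularAutomorphism G.dualφ G.dualσ :=
  Classical.epsilon_spec (p := IsModularAutomorphism G.dualφ)
    ⟨_, isModularAutomorphism_of_faithful G.eq_zero_of_dualφ_mul_left G.dualφ_mul_comm⟩

lemma dualσ_eq : G.dualσ = G.dualS.symm.trans (G.dualAut.symm.trans G.dualS) :=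
  modularAutomorphism_eq G.eq_zero_of_dualφ_mul_left G.dualφ_mul_comm

lemma dualσ_val (b : G.Dual) (a : A) :
    (G.dualσ b).1 a = b.1 (G.δR.symm (G.S (G.S a))) := by
  obtain ⟨x, rfl⟩ := G.dualS.surjective b
  obtain ⟨z, rfl⟩ := G.dualAut.surjective x
  rw [dualσ_eq]
  simp only [LinearEquiv.trans_apply, LinearEquiv.symm_apply_apply]
  rw [dualS_val, dualS_val, dualAut_val, LinearEquiv.symm_apply_apply, ← S_δL,
    LinearEquiv.symm_apply_apply, LinearEquiv.symm_apply_apply]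

/-! ### The modular element of the dual -/

/-- Right multiplication by `δ̂`. -/
noncomputable def dualδR : G.Dual ≃ₗ[ℂ] G.Dual :=
  G.F.symm.trans ((G.S2.symm.trans (G.σ.trans
    (LinearEquiv.smulOfNeZero ℂ A G.τ G.τ_ne_zero))).trans G.F)

/-- Left multiplication by `δ̂`. -/
noncomputable def dualδL : G.Dual ≃ₗ[ℂ] G.Dual :=
  G.F.symm.trans ((G.S2.trans (G.δR.symm.trans (G.σ.trans (G.δL.trans
    (LinearEquiv.smulOfNeZero ℂ A G.τ⁻¹ (inv_ne_zero G.τ_ne_zero)))))).trans G.F)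

lemma dualδR_F (c : A) : G.dualδR (G.F c) = G.F (G.τ • G.σ (G.S2.symm c)) := by
  simp [dualδR]

lemma dualδL_F (c : A) :
    G.dualδL (G.F c) = G.F (G.τ⁻¹ • G.δL (G.σ (G.δR.symm (G.S2 c)))) := by
  simp [dualδL]

lemma dualδR_val (b : G.Dual) (a : A) : (G.dualδR b).1 a = b.1 (G.S2 (G.σ.symm a)) := by
  obtain ⟨c, rfl⟩ := G.F.surjective b
  obtain ⟨c, rfl⟩ := G.S2.surjective c
  rw [dualδR_F, F_val, F_val, LinearEquiv.symm_apply_apply, mul_smul_comm, map_smul,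
    ← φ_mul_comm, ← S2_mul, S2_apply, φ_S_S_eq, G.φ_mul_σ_symm c a, smul_eq_mul]

lemma dualδL_val (b : G.Dual) (a : A) :
    (G.dualδL b).1 a = b.1 (G.S2.symm (G.σ'.symm a)) := by
  obtain ⟨c, rfl⟩ := G.F.surjective b
  obtain ⟨a, rfl⟩ := G.σ'.surjective a
  obtain ⟨a, rfl⟩ := G.S2.surjective a
  rw [dualδL_F, F_val, F_val, LinearEquiv.symm_apply_apply, LinearEquiv.symm_apply_apply,
    mul_smul_comm, map_smul, smul_eq_mul, inv_mul_eq_iff_eq_mul₀ G.τ_ne_zero, ← φ_S_S_eq,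
    ← S2_apply, S2_mul, mul_δL, ← φ_mul_comm]
  generalize G.S2 c = w
  generalize G.S2 a = x
  rw [← δR_mul, ← φ_S, S_mul, S_δR_symm, σ'_apply, LinearEquiv.apply_symm_apply,
    ← G.φ_mul_σ_symm, ← δL_mul, ← S_mul, ← φ_S_symm, LinearEquiv.symm_apply_apply]

lemma χ_actR (b : G.Dual) (a : A) : G.χ (b.actR a) = (G.dualδR b).1 a := by
  obtain ⟨c, rfl⟩ := G.F.surjective b
  rw [dualδR_val, actR_F, apply_sliceL, sliceR_χ_T₃, F_val]

lemma χ_actL (b : G.Dual) (a : A) : G.χ (b.actL a) = (G.dualδL b).1 a := by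
  obtain ⟨c, rfl⟩ := G.F.surjective b
  rw [dualδL_val, actL_F, ← apply_sliceL, sliceL_χ_T₁, F_val]

/-- Both sides at a equal χ of a acted on by b and b' from the two sides; the two actions commute by
coassociativity. -/
lemma mul_dualδL (b b' : G.Dual) : b * G.dualδL b' = G.dualδR b * b' := Dual.ext fun a => by
  rw [Dual.mul_val, Dual.mul_val, ← χ_actL, ← Dual.val_actL, ← χ_actR, Dual.actL_actR]

lemma dualφ_dualδR (b : G.Dual) : G.dualφ (G.dualS b) = G.dualφ (G.dualδR b) := by
  obtain ⟨c, rfl⟩ := G.F.surjective b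
  rw [dualφ_dualS, dualψ_F, dualδR_F, dualφ_F, map_smul, χ_σ, smul_eq_mul,
    inv_mul_cancel_left₀ G.τ_ne_zero, ← G.ε_S2 (G.S2.symm c),
    LinearEquiv.apply_symm_apply]

/-- On the Fourier side the factor τ⁻¹ in `dualδL` cancels the factor τ that χ acquires from δ, and
χ ∘ S = ε ∘ σ does the rest. -/
lemma dualφ_dualδL (b : G.Dual) : G.dualφ (G.dualS.symm b) = G.dualφ (G.dualδL b) := by
  obtain ⟨b, rfl⟩ := G.dualS.surjective b
  obtain ⟨c, rfl⟩ := G.F.surjective b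
  obtain ⟨c, rfl⟩ := G.S.surjective c
  rw [LinearEquiv.symm_apply_apply, dualS_F, dualδL_F, dualφ_F, dualφ_F, map_smul, χ_δL, χ_σ,
    ε_δR_symm, ε_S2, ε_δL, χ_S, smul_eq_mul, inv_mul_cancel_left₀ G.τ_ne_zero,
    LinearEquiv.symm_apply_apply]

/-- `δ̂`, from its left and right multiplication. -/
noncomputable def dualδUnit : (Multiplier G.Dual)ˣ :=
  Multiplier.unitOfEquiv G.dualδL G.dualδR G.mul_dualδL

lemma isModularElement_dualδUnit : IsModularElement G.dualS G.dualφ G.dualδUnit :=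
  fun b => ⟨G.dualφ_dualδR b, G.dualφ_dualδL b⟩

lemma isModularElement_dualδ : IsModularElement G.dualS G.dualφ G.dualδ :=
  Classical.epsilon_spec (p := IsModularElement G.dualS G.dualφ)
    ⟨_, G.isModularElement_dualδUnit⟩

lemma dualδ_eq : G.dualδ = G.dualδUnit :=
  isModularElement_unique G.eq_zero_of_dualφ_mul_left G.eq_zero_of_dualφ_mul_right
    G.isModularElement_dualδ G.isModularElement_dualδUnit

/-! ### The extended pairing -/

-- The elements a ◁ b span A, because slices of `T₃` by φ exhaust it; the first condition alone
-- therefore determines the functional.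
variable {G} in
lemma IsExtendedPairing.unique {m : Multiplier G.Dual} {f g : A →ₗ[ℂ] ℂ}
    (hf : G.IsExtendedPairing m f) (hg : G.IsExtendedPairing m g) : f = g := by
  refine LinearMap.ext fun x => ?_
  obtain ⟨t, rfl⟩ := (sliceL_surjective G.φ_ne_zero).comp G.T₃.surjective x
  induction t with
  | zero => simp
  | add s t hs ht =>
    simp only [Function.comp_apply, map_add] at hs ht ⊢
    rw [hs, ht]
  | tmul a c => rw [Function.comp_apply, ← actR_F, hf.1, hg.1]

variable {G} in
lemma IsExtendedPairing.pairing {m : Multiplier G.Dual} {f : A →ₗ[ℂ] ℂ}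
    (hf : G.IsExtendedPairing m f) : G.IsExtendedPairing m (G.pairing m) :=
  Classical.epsilon_spec (p := G.IsExtendedPairing m) ⟨f, hf⟩

lemma isExtendedPairing_dualδ : G.IsExtendedPairing ↑G.dualδ G.χ := by
  rw [dualδ_eq]
  exact ⟨fun a b => G.χ_actR b a, fun a b => G.χ_actL b a⟩

lemma σ'_symm_S2 (a : A) : G.σ'.symm (G.S2 a) = G.S2 (G.σ'.symm a) := by
  simp only [σ'_symm_apply, S2_apply, σ_S_S]
  simp

/-- Slicing Δ by ε ∘ σ gives S⁻²σ on one side and S²σ' on the other. These invert S²σ⁻¹ and S⁻²σ'⁻¹,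
the maps dual to multiplication by the dual modular element, since S² commutes with σ and σ'. -/
lemma isExtendedPairing_dualδ_inv :
    G.IsExtendedPairing ↑G.dualδ⁻¹ (G.ε ∘ₗ G.σ.toLinearMap) := by
  rw [dualδ_eq]
  constructor
  · intro a b
    obtain ⟨x, rfl⟩ := G.dualδR.surjective b
    have h1 : (↑G.dualδUnit⁻¹ : Multiplier G.Dual).rmul (G.dualδR x) = x :=
      G.dualδR.symm_apply_apply x
    have h2 : ∀ b : G.Dual, (G.ε ∘ₗ G.σ.toLinearMap) (b.actR a) = b.1 (G.S2.symm (G.σ a)) := by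
      intro b
      obtain ⟨c, rfl⟩ := G.F.surjective b
      rw [actR_F, apply_sliceL, sliceR_εσ_T₃, F_val]
    have h3 := G.σ_symm_S_S (G.S2.symm (G.σ a))
    rw [← S2_apply, ← S2_apply, LinearEquiv.apply_symm_apply, LinearEquiv.symm_apply_apply] at h3
    rw [h1, h2, dualδR_val, ← h3]
  · intro a b
    obtain ⟨x, rfl⟩ := G.dualδL.surjective b
    have h1 : (↑G.dualδUnit⁻¹ : Multiplier G.Dual).lmul (G.dualδL x) = x :=
      G.dualδL.symm_apply_apply x
    have h2 : ∀ b : G.Dual, (G.ε ∘ₗ G.σ.toLinearMap) (b.actL a) = b.1 (G.S2 (G.σ' a)) := by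
      intro b
      obtain ⟨c, rfl⟩ := G.F.surjective b
      rw [actL_F, ← apply_sliceL, sliceL_εσ_T₁, F_val]
    rw [h1, h2, dualδL_val, σ'_symm_S2, LinearEquiv.symm_apply_apply, LinearEquiv.symm_apply_apply]

end AlgebraicQuantumGroup

theorem proposition2p3 {A : Type*} [NonUnitalRing A] [Module ℂ A] [SMulCommClass ℂ A A]
    [IsScalarTower ℂ A A] (G : AlgebraicQuantumGroup A) :
    -- the objects in the formulas exist, that is, they have their defining properties
    (G.IsCounit G.ε ∧ G.IsAntipode G.S ∧
      IsModularAutomorphism G.φ G.σ ∧ IsModularAutomorphism G.ψ G.σ' ∧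
      IsModularElement G.S G.φ G.δ ∧
      G.IsDualPhi G.dualφ ∧ G.IsDualPsi G.dualψ ∧ G.IsDualAntipode G.dualS ∧
      IsModularAutomorphism G.dualφ G.dualσ ∧ IsModularAutomorphism G.dualψ G.dualσ' ∧
      IsModularElement G.dualS G.dualφ G.dualδ ∧
      G.IsExtendedPairing ↑G.dualδ (G.pairing ↑G.dualδ) ∧
      G.IsExtendedPairing ↑G.dualδ⁻¹ (G.pairing ↑G.dualδ⁻¹)) ∧
    -- the pairing with the dual modular element and its inverse
    (∀ a : A, G.pairing ↑G.dualδ a = G.ε (G.σ.symm a) ∧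
      G.ε (G.σ.symm a) = G.ε (G.σ'.symm a)) ∧
    (∀ a : A, G.pairing ↑G.dualδ⁻¹ a = G.ε (G.σ a) ∧ G.ε (G.σ a) = G.ε (G.σ' a)) ∧
    -- the dual modular automorphisms
    (∀ (a : A) (b : G.Dual), (G.dualσ b).1 a =
      b.1 ((↑G.δ⁻¹ : Multiplier A).rmul (G.S (G.S a)))) ∧
    (∀ (a : A) (b : G.Dual), (G.dualσ' b).1 a =
      b.1 ((↑G.δ⁻¹ : Multiplier A).lmul (G.S.symm (G.S.symm a)))) ∧
    -- the Plancherel formula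
    (∀ (c c' : A) (b b' : G.Dual), (∀ x, b.1 x = G.φ (x * c)) → (∀ x, b'.1 x = G.φ (x * c')) →
      G.dualψ (b * b') = G.φ (G.S.symm c' * c)) := by

  have hδ := G.isExtendedPairing_dualδ
  have hδ' := G.isExtendedPairing_dualδ_inv
  -- The pairing is an arbitrary choice among functionals with the defining property; uniqueness
  -- identifies it with the explicit one.
  have e1 : G.pairing ↑G.dualδ = G.χ := hδ.pairing.unique hδ
  have e2 : G.pairing ↑G.dualδ⁻¹ = G.ε ∘ₗ G.σ.toLinearMap := hδ'.pairing.unique hδ'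
  refine ⟨⟨G.isCounit_ε, G.isAntipode_S, G.isModularAutomorphism_σ, G.isModularAutomorphism_σ',
    G.isModularElement_δ, G.isDualPhi_dualφ, G.isDualPsi_dualψ, G.isDualAntipode_dualS,
    G.isModularAutomorphism_dualσ, G.isModularAutomorphism_dualσ', G.isModularElement_dualδ,
    hδ.pairing, hδ'.pairing⟩, fun a => ⟨?_, (G.ε_σ'_symm a).symm⟩, fun a => ⟨?_, (G.ε_σ' a).symm⟩,
    fun a b => G.dualσ_val b a, fun a b => ?_, fun c c' b b' hb hb' => ?_⟩
  · rw [e1, G.χ_apply]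
  · rw [e2]; rfl
  · rw [G.dualσ'_eq, G.dualAut_val, G.δL_symm_apply]
  · rw [G.eq_F hb, G.eq_F hb', G.dualψ_F_mul_F]
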